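/- **Theorem.** Consider the three-multipeakon system of the Degasperis–Procesi equation, $$\dot x_k=\sum_{i=1}^3 m_i e^{-|x_k-x_i|},\qquad \dot m_k=2m_k\sum_{i=1}^3 m_i\,\mathrm{sgn}(x_k-x_i)\,e^{-|x_k-x_i|}\qquad(k=1,2,3),$$ in the sector $x_1<x_2<x_3$, with initial data $x_1(0)<x_2(0)<x_3(0)$ and $m_i(0)\ne 0$ whose sign pattern $(\mathrm{sgn}\,m_1(0),\mathrm{sgn}\,m_2(0),\mathrm{sgn}\,m_3(0))$ is one of $(-++)$, $(--+)$, $(++-)$, $(+--)$. Put $J=[0,\infty)$ and consider $t\to+\infty$ for $(-++)$ and $(--+)$; put $J=(-\infty,0]$ and consider $t\to-\infty$ for $(++-)$ and $(+--)$. Then: 1. There is a unique solution in the sector $x_1<x_2<x_3$ on the whole half-line $J$ with these initial data. 2. In the given time direction the limits $\mu_i=\lim m_i(t)$ exist and are nonzero and pairwise distinct; moreover $\dot x_i(t)\to\mu_i$, and the peakons separate linearly: $(x_j(t)-x_i(t))/|t|\to|\mu_j-\mu_i|>0$ for $i<j$. 3. For $t\in J$ call $z\in\mathbb C$ an eigenvalue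 if there is a solution $\Psi$ of $(\partial_x-\partial_x^3)\Psi=z\,m\,\Psi$, $m=2\sum_{i=1}^3 m_i(t)\,\delta_{x_i(t)}$, such that $\Psi\sim e^x$ as $x\to-\infty$ and $\Psi$ is bounded as $x\to+\infty$. For every $t\in J$ the eigenvalues are exactly the zeros of $$A(z)=1-M_1z+M_2z^2-M_3z^3,$$ where $$M_1=m_1+m_2+m_3,$$ $$M_2=m_1m_2(1-e^{x_1-x_2})^2+m_2m_3(1-e^{x_2-x_3})^2+m_1m_3(1-e^{x_1-x_3})^2,$$ $$M_3=m_1m_2m_3(1-e^{x_1-x_2})^2(1-e^{x_2-x_3})^2 .$$ All zeros of $A$ in $\mathbb C$ are real, simple and nonzero, and they are exactly $1/\mu_1,\,1/\mu_2,\,1/\mu_3$. -/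

import Mathlib

open Filter Topology Set Polynomial

noncomputable section

namespace Peakon

/-- The velocity field `u (x_k) = ∑ i, m_i * exp (-|x_k - x_i|)` at the `k`-th peakon. -/
def velocity {n : ℕ} (x m : Fin n → ℝ) (k : Fin n) : ℝ :=
  ∑ i, m i * Real.exp (-|x k - x i|)

/-- The right-hand side of the equation for the `k`-th mass of the Degasperis-Procesi
multipeakon system: `2 * m_k * ∑ i, m_i * sgn (x_k - x_i) * exp (-|x_k - x_i|)`. -/
def massRate {n : ℕ} (x m : Fin n → ℝ) (k : Fin n) : ℝ :=
  2 * m k * ∑ i, m i * (SignType.sign (x k - x i) : ℝ) * Real.exp (-|x k - x i|)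

/-- `t ↦ (x t, m t)` solves the Degasperis-Procesi multipeakon system on the time set `J`,
without collisions: the positions stay strictly ordered, `x_1 < ... < x_n`.
Derivatives are one-sided at the end points of `J`. -/
structure IsSolutionOn {n : ℕ} (J : Set ℝ) (x m : ℝ → Fin n → ℝ) : Prop where
  ordered : ∀ t ∈ J, StrictMono (x t)
  position : ∀ t ∈ J, ∀ k, HasDerivWithinAt (fun s => x s k) (velocity (x t) (m t) k) J t
  mass : ∀ t ∈ J, ∀ k, HasDerivWithinAt (fun s => m s k) (massRate (x t) (m t) k) J t

/-- First constant of motion for three peakons. -/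
def M₁ (m : Fin 3 → ℝ) : ℝ := m 0 + m 1 + m 2

/-- Second constant of motion for three peakons. -/
def M₂ (x m : Fin 3 → ℝ) : ℝ :=
  m 0 * m 1 * (1 - Real.exp (x 0 - x 1)) ^ 2 + m 1 * m 2 * (1 - Real.exp (x 1 - x 2)) ^ 2
    + m 0 * m 2 * (1 - Real.exp (x 0 - x 2)) ^ 2

/-- Third constant of motion for three peakons. -/
def M₃ (x m : Fin 3 → ℝ) : ℝ :=
  m 0 * m 1 * m 2 * (1 - Real.exp (x 0 - x 1)) ^ 2 * (1 - Real.exp (x 1 - x 2)) ^ 2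

/-- The polynomial `A(z) = 1 - M₁ z + M₂ z² - M₃ z³` of the three-peakon spectral problem. -/
def specPoly (x m : Fin 3 → ℝ) : ℂ[X] :=
  1 - C (M₁ m : ℂ) * X + C (M₂ x m : ℂ) * X ^ 2 - C (M₃ x m : ℂ) * X ^ 3

/-- `Ψ` solves the boundary value problem `(∂ - ∂³) Ψ = z m Ψ`, `m = 2 ∑ m_i δ_{x_i}`, with
`Ψ ∼ exp` at `-∞` and `Ψ` bounded at `+∞`. Since `m Ψ` is a combination of point masses, the
distributional equation says that `Ψ` is `C¹`, that `Ψ' = Ψ'''` off the points `x_i`, and that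
`Ψ''` jumps by `-2 z m_i Ψ(x_i)` at `x_i`. -/
structure IsEigenfunction {n : ℕ} (x m : Fin n → ℝ) (z : ℂ) (Ψ : ℝ → ℂ) : Prop where
  contDiff : ContDiff ℝ 1 Ψ
  equation : ∀ y, (∀ i, y ≠ x i) →
    ContDiffAt ℝ 3 Ψ y ∧ deriv Ψ y - deriv (deriv (deriv Ψ)) y = 0
  jump : ∀ i, ∃ L R : ℂ, Tendsto (deriv (deriv Ψ)) (𝓝[<] (x i)) (𝓝 L) ∧
    Tendsto (deriv (deriv Ψ)) (𝓝[>] (x i)) (𝓝 R) ∧ -(R - L) = z * (2 * (m i : ℂ)) * Ψ (x i)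
  left : Tendsto (fun y => Ψ y / (Real.exp y : ℂ)) atBot (𝓝 1)
  right : ∃ K : ℝ, ∀ᶠ y in atTop, ‖Ψ y‖ ≤ K

/-- `z` is an eigenvalue of the boundary value problem of the peakon configuration `(x, m)`. -/
def IsEigenvalue {n : ℕ} (x m : Fin n → ℝ) (z : ℂ) : Prop :=
  ∃ Ψ : ℝ → ℂ, IsEigenfunction x m z Ψ

end Peakon

end

open Filter Topology Set Polynomial

noncomputable section

namespace Peakon

/-! The system has two symmetries. One reverses time and negates the masses. The other reflects the
line, reverses the order of the peakons and negates the masses. Together they reduce all four sign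
patterns to $(-++)$ with $t\to+\infty$. There, with masses $a<0<b,c$ and $p=e^{x_1-x_2}$,
$q=e^{x_2-x_3}$ in $(0,1)$, the equations close up polynomially, and the signs as well as $0<p,q<1$
persist, so no collision occurs. Then $a$ increases, $b$ decreases and $a+b+c$ is constant. This
bounds the masses, hence the velocities, and gives global existence. Monotonicity also yields limits
$\alpha,\beta,\gamma$ of the masses (`exists_tendsto`). The constant $M_3<0$ keeps them nonzero, and
$b\ge\beta>0$ makes $p$ decay exponentially. Constancy of $M_3$ then forces $q$ to converge, and
convergence of both $b$ and $\dot b$ forces $q\to0$. Finally $\gamma\le\beta$ is impossible: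
eventually $b\ge c$ would hold, and $\frac{d}{dt}\log\frac{q}{1-q}=ap+b-c$ would be bounded below by
an integrable function, against $q\to0$. Since $p,q\to0$, the conserved $M_1,M_2,M_3$ equal the
elementary symmetric functions of the limits, so $A(z)=\prod(1-\mu_iz)$ at every time. For the
spectrum, $\Psi$ is a combination of $1,e^y,e^{-y}$ between peakons. Transporting the coefficients
from $\Psi=e^y$ on the left across the three jumps gives $A(z)$ as the coefficient of $e^y$ on the
right, and boundedness means that it vanishes (`IsEigenfunction.isRoot`, `isEigenvalue_of_isRoot`).
-/

/-! ### Ordinary differential equations with an a priori bound -/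

section ODE

variable {E : Type*} [NormedAddCommGroup E] [NormedSpace ℝ E] [FiniteDimensional ℝ E]

/-- Integral curves of a `C¹` vector field are determined by their initial value. -/
theorem eqOn_Icc_of_hasDerivWithinAt {V : E → E} (hV : ContDiff ℝ 1 V) {T : ℝ} {y z : ℝ → E}
    (hy : ∀ t ∈ Icc 0 T, HasDerivWithinAt y (V (y t)) (Icc 0 T) t)
    (hz : ∀ t ∈ Icc 0 T, HasDerivWithinAt z (V (z t)) (Icc 0 T) t) (h0 : y 0 = z 0) :
    EqOn y z (Icc 0 T) := by
  have : ProperSpace E := FiniteDimensional.proper ℝ E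
  have hyc : ContinuousOn y (Icc 0 T) := fun t ht => (hy t ht).continuousWithinAt
  have hzc : ContinuousOn z (Icc 0 T) := fun t ht => (hz t ht).continuousWithinAt
  -- Both curves stay in one closed ball, and on that compact convex set a $C^1$ field is Lipschitz.
  obtain ⟨R, hR⟩ := ((isCompact_Icc.image_of_continuousOn hyc).union
    (isCompact_Icc.image_of_continuousOn hzc)).isBounded.subset_closedBall (0 : E)
  obtain ⟨K, hK⟩ := hV.contDiffOn.exists_lipschitzOnWith one_ne_zero
    (convex_closedBall (0 : E) R) (isCompact_closedBall _ _)
  refine ODE_solution_unique_of_mem_Icc_right (v := fun _ => V)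
    (s := fun _ => Metric.closedBall 0 R) (K := K) (fun _ _ => hK) hyc (fun t ht => ?_)
    (fun t ht => hR (Or.inl ⟨t, Ico_subset_Icc_self ht, rfl⟩)) hzc (fun t ht => ?_)
    (fun t ht => hR (Or.inr ⟨t, Ico_subset_Icc_self ht, rfl⟩)) h0
  · exact (hy t (Ico_subset_Icc_self ht)).mono_of_mem_nhdsWithin (Icc_mem_nhdsGE_of_mem ht)
  · exact (hz t (Ico_subset_Icc_self ht)).mono_of_mem_nhdsWithin (Icc_mem_nhdsGE_of_mem ht)

/-- Integral curves of a `C¹` vector field on `[0, ∞)` are determined by their initial value. -/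
theorem eqOn_Ici_of_hasDerivWithinAt {V : E → E} (hV : ContDiff ℝ 1 V) {y z : ℝ → E}
    (hy : ∀ t ∈ Ici (0 : ℝ), HasDerivWithinAt y (V (y t)) (Ici 0) t)
    (hz : ∀ t ∈ Ici (0 : ℝ), HasDerivWithinAt z (V (z t)) (Ici 0) t) (h0 : y 0 = z 0) :
    EqOn y z (Ici 0) := fun t ht =>
  eqOn_Icc_of_hasDerivWithinAt hV (T := t)
    (fun s hs => (hy s hs.1).mono Icc_subset_Ici_self)
    (fun s hs => (hz s hs.1).mono Icc_subset_Ici_self) h0 ⟨ht, le_rfl⟩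

/-- A compactly supported `C¹` vector field has integral curves on every interval `[0, T]`. -/
theorem exists_integralCurve_of_hasCompactSupport {W : E → E} (hW : ContDiff ℝ 1 W)
    (hc : HasCompactSupport W) (x₀ : E) {T : ℝ} (hT : 0 ≤ T) :
    ∃ y : ℝ → E, y 0 = x₀ ∧ ∀ t ∈ Icc 0 T, HasDerivWithinAt y (W (y t)) (Icc 0 T) t := by
  have : CompleteSpace E := FiniteDimensional.complete ℝ E
  obtain ⟨K, hK⟩ := hW.lipschitzWith_of_hasCompactSupport hc one_ne_zero
  obtain ⟨C, hC⟩ := hW.continuous.bounded_above_of_compact_support hc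
  have hC0 : 0 ≤ C := (norm_nonneg _).trans (hC x₀)
  -- Speed at most $C$ cannot leave the ball of radius $CT$ within time $T$, so the Picard–Lindelöf
  -- condition on the time interval holds for every $T$.
  have hPL : IsPicardLindelof (fun _ : ℝ => W) (tmin := 0) (tmax := T) ⟨0, le_rfl, hT⟩ x₀
      (⟨C * T, mul_nonneg hC0 hT⟩ : NNReal) 0 ⟨C, hC0⟩ K :=
    { lipschitzOnWith := fun _ _ => hK.lipschitzOnWith
      continuousOn := fun _ _ => continuousOn_const
      norm_le := fun _ _ x _ => hC x
      mul_max_le := by simpa [hT] using! le_rfl }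
  exact hPL.exists_eq_forall_mem_Icc_hasDerivWithinAt₀

/-- A `C¹` vector field for which all integral curves from `x₀` satisfy an a priori bound on
`[0, T]` has an integral curve from `x₀` on `[0, T]`. -/
theorem exists_integralCurve_Icc_of_bound {V : E → E} (hV : ContDiff ℝ 1 V) (x₀ : E) {T R : ℝ}
    (hT : 0 ≤ T)
    (hR : ∀ τ ∈ Icc 0 T, ∀ y : ℝ → E, y 0 = x₀ →
      (∀ t ∈ Icc 0 τ, HasDerivWithinAt y (V (y t)) (Icc 0 τ) t) → ‖y τ‖ < R) :
    ∃ y : ℝ → E, y 0 = x₀ ∧ ∀ t ∈ Icc 0 T, HasDerivWithinAt y (V (y t)) (Icc 0 T) t := by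
  have hR0 : ‖x₀‖ < R := hR 0 ⟨le_rfl, hT⟩ (fun _ => x₀) rfl fun t ht => by
    rw [Icc_self] at ht ⊢
    rw [mem_singleton_iff.1 ht]
    exact HasFDerivWithinAt.of_subsingleton subsingleton_singleton
  have hRpos : 0 < R := (norm_nonneg _).trans_lt hR0
  -- The cut-off field `χ • V` is compactly supported and equals `V` on the closed ball of radius
  -- `R`. It remains to see that its curve never leaves that ball.
  let χ : ContDiffBump (0 : E) := ⟨R, R + 1, hRpos, by linarith⟩
  obtain ⟨y, hy0, hy⟩ := exists_integralCurve_of_hasCompactSupport (W := fun x => χ x • V x)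
    (χ.contDiff.smul hV) (χ.hasCompactSupport.smul_right) x₀ hT
  have hyc : ContinuousOn y (Icc 0 T) := fun t ht => (hy t ht).continuousWithinAt
  have hsmall : ∀ t, ‖y t‖ ≤ R → χ (y t) • V (y t) = V (y t) := fun t ht => by
    rw [χ.one_of_mem_closedBall (by simpa using ht), one_smul]
  have hbound : ∀ t ∈ Icc 0 T, ‖y t‖ < R := by
    by_contra! h
    obtain ⟨t₁, ht₁, hRt₁⟩ := h
    have hcomp : IsCompact (Icc 0 T ∩ (fun t => ‖y t‖) ⁻¹' Ici R) :=
      isCompact_Icc.of_isClosed_subset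
        (hyc.norm.preimage_isClosed_of_isClosed isClosed_Icc isClosed_Ici) inter_subset_left
    -- At the first exit time `τ` the curve has so far followed `V` itself, so the a priori bound
    -- applies at `τ` and contradicts the exit.
    obtain ⟨τ, ⟨hτ, hRτ⟩, hmin⟩ := hcomp.exists_isLeast ⟨t₁, ht₁, hRt₁⟩
    have hlt : ∀ t ∈ Ico 0 τ, ‖y t‖ < R := fun t ht => by
      by_contra! hle
      exact absurd (hmin ⟨⟨ht.1, ht.2.le.trans hτ.2⟩, hle⟩) (not_le.2 ht.2)
    have hle : ∀ t ∈ Icc 0 τ, ‖y t‖ ≤ R := by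
      intro t ht
      rcases hτ.1.eq_or_lt with h | h
      · have : t = 0 := le_antisymm (ht.2.trans h.symm.le) ht.1
        rw [this, hy0]; exact hR0.le
      · have hcl : closure (Ico 0 τ) = Icc 0 τ := closure_Ico h.ne
        exact ContinuousWithinAt.closure_le (s := Ico 0 τ) (f := fun t => ‖y t‖) (g := fun _ => R)
          (hcl ▸ ht)
          ((hyc t ⟨ht.1, ht.2.trans hτ.2⟩).norm.mono
            (Ico_subset_Icc_self.trans (Icc_subset_Icc_right hτ.2)))
          continuousWithinAt_const (fun s hs => (hlt s hs).le)
    refine absurd (hR τ hτ y hy0 fun t ht => ?_) (not_lt.2 hRτ)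
    rw [← hsmall t (hle t ht)]
    exact (hy t ⟨ht.1, ht.2.trans hτ.2⟩).mono (Icc_subset_Icc_right hτ.2)
  exact ⟨y, hy0, fun t ht => hsmall t (hbound t ht).le ▸ hy t ht⟩

/-- A `C¹` vector field for which all integral curves from `x₀` satisfy a priori bounds on bounded
time intervals has an integral curve from `x₀` on `[0, ∞)`. -/
theorem exists_integralCurve_Ici_of_bound {V : E → E} (hV : ContDiff ℝ 1 V) (x₀ : E) (R : ℝ → ℝ)
    (hR : ∀ T, 0 ≤ T → ∀ τ ∈ Icc 0 T, ∀ y : ℝ → E, y 0 = x₀ →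
      (∀ t ∈ Icc 0 τ, HasDerivWithinAt y (V (y t)) (Icc 0 τ) t) → ‖y τ‖ < R T) :
    ∃ y : ℝ → E, y 0 = x₀ ∧ ∀ t ∈ Ici (0 : ℝ), HasDerivWithinAt y (V (y t)) (Ici 0) t := by
  have hex : ∀ n : ℕ, ∃ y : ℝ → E, y 0 = x₀ ∧
      ∀ t ∈ Icc (0 : ℝ) n, HasDerivWithinAt y (V (y t)) (Icc 0 (n : ℝ)) t := fun n =>
    exists_integralCurve_Icc_of_bound hV x₀ n.cast_nonneg (hR n n.cast_nonneg)
  choose Y hY0 hY using hex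
  have hagree : ∀ n k : ℕ, n ≤ k → EqOn (Y n) (Y k) (Icc 0 n) := fun n k hnk =>
    eqOn_Icc_of_hasDerivWithinAt hV (hY n) (fun t ht =>
      (hY k t ⟨ht.1, ht.2.trans (by exact_mod_cast hnk)⟩).mono
        (Icc_subset_Icc_right (by exact_mod_cast hnk))) ((hY0 n).trans (hY0 k).symm)
  have hglue : ∀ n : ℕ, EqOn (fun t => Y ⌈t⌉₊ t) (Y n) (Icc 0 n) := fun n t ht =>
    hagree _ _ (Nat.ceil_le.2 ht.2) ⟨ht.1, Nat.le_ceil t⟩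
  refine ⟨fun t => Y ⌈t⌉₊ t, by simp [hY0], fun t ht => ?_⟩
  -- The extra $1$ puts `t` strictly below the right end point, so that $[0,n]$ is a neighbourhood
  -- of `t` within $[0,\infty)$.
  have htn : t < (⌈t⌉₊ + 1 : ℕ) := by push_cast; linarith [Nat.le_ceil t]
  have hmem : t ∈ Icc (0 : ℝ) (⌈t⌉₊ + 1 : ℕ) := ⟨ht, htn.le⟩
  have hd := (hY _ t hmem).congr (hglue _) (hglue _ hmem)
  rw [← hglue _ hmem] at hd
  exact hd.mono_of_mem_nhdsWithin
    (mem_nhdsWithin.2 ⟨Iio _, isOpen_Iio, htn, fun s hs => ⟨hs.2, hs.1.le⟩⟩)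

end ODE

/-- A solution of a scalar linear homogeneous equation which is initially positive stays
positive. -/
theorem pos_of_hasDerivWithinAt_mul {f g : ℝ → ℝ} {T : ℝ}
    (hf : ∀ t ∈ Icc 0 T, HasDerivWithinAt f (f t * g t) (Icc 0 T) t)
    (hg : ContinuousOn g (Icc 0 T)) (h0 : 0 < f 0) : ∀ t ∈ Icc 0 T, 0 < f t := by
  obtain ⟨K, hK⟩ := isCompact_Icc.exists_bound_of_continuousOn hg
  have hfc : ContinuousOn f (Icc 0 T) := fun t ht => (hf t ht).continuousWithinAt
  -- With $|g|\le K$ this is a Grönwall weight: the derivative is $2f^2(g+K)e^{2Kt}\ge0$. Hence $f$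
  -- cannot vanish, and a sign change is excluded by the intermediate value theorem.
  have hmono : MonotoneOn (fun t => f t ^ 2 * Real.exp (2 * K * t)) (Icc 0 T) := by
    refine monotoneOn_of_hasDerivWithinAt_nonneg (convex_Icc 0 T)
      (f' := fun t => 2 * f t ^ 2 * (g t + K) * Real.exp (2 * K * t))
      ((hfc.pow 2).mul (by fun_prop)) (fun t ht => ?_) (fun t ht => ?_)
    · rw [interior_Icc] at ht ⊢
      have h1 := (hf t (Ioo_subset_Icc_self ht)).mono Ioo_subset_Icc_self
      have h2 : HasDerivWithinAt (fun t => Real.exp (2 * K * t))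
          (Real.exp (2 * K * t) * (2 * K * 1)) (Ioo 0 T) t :=
        (((hasDerivAt_id t).const_mul (2 * K)).exp).hasDerivWithinAt
      refine ((h1.pow 2).mul h2).congr_deriv ?_
      simp only [Pi.pow_apply]
      push_cast
      ring
    · have := (abs_le.1 (hK t (interior_subset ht))).1
      have h2 : 0 ≤ g t + K := by linarith
      positivity
  have hne : ∀ t ∈ Icc 0 T, f t ≠ 0 := fun t ht h => by
    have h1 := hmono ⟨le_rfl, ht.1.trans ht.2⟩ ht ht.1
    simp only [h] at h1
    have : 0 < f 0 ^ 2 * Real.exp (2 * K * 0) := by positivity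
    norm_num at h1 this
    exact absurd h1 (by linarith)
  intro t ht
  by_contra! hle
  obtain ⟨s, hs, hs0⟩ := intermediate_value_Icc' ht.1
    (hfc.mono (Icc_subset_Icc_right ht.2)) ⟨hle, h0.le⟩
  exact hne s ⟨hs.1, hs.2.trans ht.2⟩ hs0

end Peakon

namespace Peakon

/-! ### Calculus on half-lines -/

/-- A function with vanishing derivative on a convex set is constant there. -/
theorem eq_of_hasDerivWithinAt_zero {J : Set ℝ} (hJ : Convex ℝ J) {f : ℝ → ℝ}
    (hf : ∀ t ∈ J, HasDerivWithinAt f 0 J t) {s t : ℝ} (hs : s ∈ J) (ht : t ∈ J) : f t = f s := by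
  have := hJ.norm_image_sub_le_of_norm_hasDerivWithin_le (C := 0) hf (fun _ _ => by simp) hs ht
  rw [zero_mul] at this
  exact sub_eq_zero.1 (norm_le_zero_iff.1 this)

theorem monotoneOn_of_forall_hasDerivWithinAt {J : Set ℝ} (hJ : Convex ℝ J) {f f' : ℝ → ℝ}
    (hf : ∀ t ∈ J, HasDerivWithinAt f (f' t) J t) (h0 : ∀ t ∈ J, 0 ≤ f' t) : MonotoneOn f J :=
  monotoneOn_of_hasDerivWithinAt_nonneg hJ (fun t ht => (hf t ht).continuousWithinAt)
    (fun t ht => (hf t (interior_subset ht)).mono interior_subset)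
    (fun t ht => h0 t (interior_subset ht))

theorem antitoneOn_of_forall_hasDerivWithinAt {J : Set ℝ} (hJ : Convex ℝ J) {f f' : ℝ → ℝ}
    (hf : ∀ t ∈ J, HasDerivWithinAt f (f' t) J t) (h0 : ∀ t ∈ J, f' t ≤ 0) : AntitoneOn f J :=
  antitoneOn_of_hasDerivWithinAt_nonpos hJ (fun t ht => (hf t ht).continuousWithinAt)
    (fun t ht => (hf t (interior_subset ht)).mono interior_subset)
    (fun t ht => h0 t (interior_subset ht))

/-- A bounded monotone function on a half-line converges, to an upper bound. -/
theorem exists_tendsto_of_monotoneOn_Ici {f : ℝ → ℝ} {T B : ℝ} (hf : MonotoneOn f (Ici T))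
    (hB : ∀ t ∈ Ici T, f t ≤ B) :
    ∃ l, Tendsto f atTop (𝓝 l) ∧ (∀ t ∈ Ici T, f t ≤ l) ∧ l ≤ B := by
  have hmono : Monotone fun t => f (max t T) := fun s t hst =>
    hf (mem_Ici.2 (le_max_right _ _)) (mem_Ici.2 (le_max_right _ _)) (max_le_max_right _ hst)
  have hbdd : BddAbove (range fun t => f (max t T)) :=
    ⟨B, by rintro _ ⟨t, rfl⟩; exact hB _ (mem_Ici.2 (le_max_right _ _))⟩
  refine ⟨⨆ t, f (max t T), ?_, fun t ht => ?_, ciSup_le fun t => hB _ (mem_Ici.2 (le_max_right _ _))⟩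
  · refine (tendsto_atTop_ciSup hmono hbdd).congr' ?_
    filter_upwards [eventually_ge_atTop T] with t ht
    rw [max_eq_left ht]
  · have := le_ciSup hbdd t
    rwa [max_eq_left (mem_Ici.1 ht)] at this

/-- A function whose derivative tends to `L` grows linearly with slope `L`. -/
theorem tendsto_div_of_tendsto_hasDerivWithinAt {f f' : ℝ → ℝ} {L : ℝ}
    (hf : ∀ t ∈ Ici (0 : ℝ), HasDerivWithinAt f (f' t) (Ici 0) t) (hL : Tendsto f' atTop (𝓝 L)) :
    Tendsto (fun t => f t / t) atTop (𝓝 L) := by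
  rw [Metric.tendsto_atTop] at hL ⊢
  intro ε hε
  obtain ⟨N, hN⟩ := hL (ε / 2) (half_pos hε)
  set T := max N 1
  have hT1 : 1 ≤ T := le_max_right _ _
  -- Mean value inequality for $f(t)-Lt$. The remaining constant `D` is absorbed once
  -- $t>2D/\varepsilon$.
  have hest : ∀ t ∈ Ici T, ‖(f t - L * t) - (f T - L * T)‖ ≤ ε / 2 * ‖t - T‖ := fun t ht =>
    (convex_Ici T).norm_image_sub_le_of_norm_hasDerivWithin_le
      (f := fun t => f t - L * t) (f' := fun t => f' t - L)
      (fun s hs => by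
        have h1 := (hf s (le_trans (by linarith) (mem_Ici.1 hs))).mono (Ici_subset_Ici.2
          (by linarith : (0 : ℝ) ≤ T))
        refine (h1.sub ((hasDerivAt_id s).const_mul L).hasDerivWithinAt).congr_deriv ?_
        ring)
      (fun s hs => (hN s (le_trans (le_max_left _ _) hs)).le) self_mem_Ici ht
  set D := |f T - L * T|
  refine ⟨max (T + 1) (2 * D / ε + 1), fun t ht => ?_⟩
  have ht1 : T + 1 ≤ t := (le_max_left _ _).trans ht
  have ht2 : 2 * D / ε + 1 ≤ t := (le_max_right _ _).trans ht
  have htpos : 0 < t := by linarith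
  have h := hest t (by simp only [mem_Ici]; linarith)
  rw [Real.norm_eq_abs, Real.norm_eq_abs, abs_of_nonneg (by linarith : 0 ≤ t - T)] at h
  have h3 : |f t - L * t| ≤ D + ε / 2 * (t - T) := by
    have := abs_sub_abs_le_abs_sub (f t - L * t) (f T - L * T)
    linarith
  have h4 : 2 * D < ε * t := by
    rw [← sub_pos]
    have : 2 * D / ε < t := by linarith
    rw [div_lt_iff₀ hε] at this
    linarith
  rw [Real.dist_eq, show f t / t - L = (f t - L * t) / t by field_simp, abs_div,
    abs_of_pos htpos, div_lt_iff₀ htpos]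
  have : ε / 2 * (t - T) < ε / 2 * t := by
    have : 0 < ε / 2 := half_pos hε
    nlinarith
  linarith

/-- If a function and its derivative converge, then the derivative tends to zero. -/
theorem eq_zero_of_tendsto_of_tendsto_hasDerivWithinAt {f f' : ℝ → ℝ} {L l : ℝ}
    (hf : ∀ t ∈ Ici (0 : ℝ), HasDerivWithinAt f (f' t) (Ici 0) t) (hL : Tendsto f' atTop (𝓝 L))
    (hl : Tendsto f atTop (𝓝 l)) : L = 0 :=
  tendsto_nhds_unique (tendsto_div_of_tendsto_hasDerivWithinAt hf hL)
    (hl.div_atTop tendsto_id)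

/-! ### The reduced system for three peakons -/

/-- The equations satisfied by the masses `a, b, c` of three peakons and the exponentials
`p = exp (x₁ - x₂)`, `q = exp (x₂ - x₃)`. -/
structure IsReducedSolutionOn (J : Set ℝ) (a b c p q : ℝ → ℝ) : Prop where
  deriv_a : ∀ t ∈ J, HasDerivWithinAt a (-(2 * a t * p t * (b t + c t * q t))) J t
  deriv_b : ∀ t ∈ J, HasDerivWithinAt b (2 * b t * (a t * p t - c t * q t)) J t
  deriv_c : ∀ t ∈ J, HasDerivWithinAt c (2 * c t * q t * (a t * p t + b t)) J t
  deriv_p : ∀ t ∈ J, HasDerivWithinAt p (p t * (1 - p t) * (a t - b t - c t * q t)) J t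
  deriv_q : ∀ t ∈ J, HasDerivWithinAt q (q t * (1 - q t) * (a t * p t + b t - c t)) J t

/-- The region where the first mass is negative, the others are positive, and the peakons are
ordered. -/
structure SignPattern (a b c p q : ℝ) : Prop where
  a_neg : a < 0
  b_pos : 0 < b
  c_pos : 0 < c
  p_pos : 0 < p
  p_lt : p < 1
  q_pos : 0 < q
  q_lt : q < 1

namespace IsReducedSolutionOn

variable {J : Set ℝ} {a b c p q : ℝ → ℝ}

theorem mono (h : IsReducedSolutionOn J a b c p q) {J' : Set ℝ} (hJ : J' ⊆ J) :
    IsReducedSolutionOn J' a b c p q :=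
  ⟨fun t ht => (h.deriv_a t (hJ ht)).mono hJ, fun t ht => (h.deriv_b t (hJ ht)).mono hJ,
    fun t ht => (h.deriv_c t (hJ ht)).mono hJ, fun t ht => (h.deriv_p t (hJ ht)).mono hJ,
    fun t ht => (h.deriv_q t (hJ ht)).mono hJ⟩

/-- Each of $-a,b,c,p,1-p,q,1-q$ solves $\dot f=fg$ with a continuous $g$, so none of them can reach
zero. For $1-p$ and $1-q$ this expresses that peakons do not collide. -/
theorem signPattern_Icc {T : ℝ} (h : IsReducedSolutionOn (Icc 0 T) a b c p q)
    (h0 : SignPattern (a 0) (b 0) (c 0) (p 0) (q 0)) {t : ℝ} (ht : t ∈ Icc 0 T) :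
    SignPattern (a t) (b t) (c t) (p t) (q t) := by
  have ha : ContinuousOn a (Icc 0 T) := fun s hs => (h.deriv_a s hs).continuousWithinAt
  have hb : ContinuousOn b (Icc 0 T) := fun s hs => (h.deriv_b s hs).continuousWithinAt
  have hc : ContinuousOn c (Icc 0 T) := fun s hs => (h.deriv_c s hs).continuousWithinAt
  have hp : ContinuousOn p (Icc 0 T) := fun s hs => (h.deriv_p s hs).continuousWithinAt
  have hq : ContinuousOn q (Icc 0 T) := fun s hs => (h.deriv_q s hs).continuousWithinAt
  refine ⟨?_, ?_, ?_, ?_, ?_, ?_, ?_⟩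
  · refine neg_pos.1 (pos_of_hasDerivWithinAt_mul (f := fun s => -a s)
      (g := fun s => -(2 * p s * (b s + c s * q s)))
      (fun s hs => (h.deriv_a s hs).neg.congr_deriv (by ring)) (by fun_prop)
      (neg_pos.2 h0.a_neg) t ht)
  · exact pos_of_hasDerivWithinAt_mul (g := fun s => 2 * (a s * p s - c s * q s))
      (fun s hs => (h.deriv_b s hs).congr_deriv (by ring)) (by fun_prop) h0.b_pos t ht
  · exact pos_of_hasDerivWithinAt_mul (g := fun s => 2 * q s * (a s * p s + b s))
      (fun s hs => (h.deriv_c s hs).congr_deriv (by ring)) (by fun_prop) h0.c_pos t ht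
  · exact pos_of_hasDerivWithinAt_mul (g := fun s => (1 - p s) * (a s - b s - c s * q s))
      (fun s hs => (h.deriv_p s hs).congr_deriv (by ring)) (by fun_prop) h0.p_pos t ht
  · refine sub_pos.1 (pos_of_hasDerivWithinAt_mul (f := fun s => 1 - p s)
      (g := fun s => -(p s * (a s - b s - c s * q s)))
      (fun s hs => ((h.deriv_p s hs).const_sub 1).congr_deriv (by ring)) (by fun_prop)
      (sub_pos.2 h0.p_lt) t ht)
  · exact pos_of_hasDerivWithinAt_mul (g := fun s => (1 - q s) * (a s * p s + b s - c s))
      (fun s hs => (h.deriv_q s hs).congr_deriv (by ring)) (by fun_prop) h0.q_pos t ht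
  · refine sub_pos.1 (pos_of_hasDerivWithinAt_mul (f := fun s => 1 - q s)
      (g := fun s => -(q s * (a s * p s + b s - c s)))
      (fun s hs => ((h.deriv_q s hs).const_sub 1).congr_deriv (by ring)) (by fun_prop)
      (sub_pos.2 h0.q_lt) t ht)

theorem signPattern_Ici (h : IsReducedSolutionOn (Ici 0) a b c p q)
    (h0 : SignPattern (a 0) (b 0) (c 0) (p 0) (q 0)) :
    ∀ t ∈ Ici (0 : ℝ), SignPattern (a t) (b t) (c t) (p t) (q t) := fun t ht =>
  (h.mono (J' := Icc 0 t) Icc_subset_Ici_self).signPattern_Icc h0 ⟨ht, le_rfl⟩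

theorem sum_eq (h : IsReducedSolutionOn J a b c p q) (hJ : Convex ℝ J) {s t : ℝ} (hs : s ∈ J)
    (ht : t ∈ J) : a t + b t + c t = a s + b s + c s :=
  eq_of_hasDerivWithinAt_zero hJ (f := fun t => a t + b t + c t) (fun r hr =>
    (((h.deriv_a r hr).add (h.deriv_b r hr)).add (h.deriv_c r hr)).congr_deriv (by ring)) hs ht

/-- The second constant of motion. -/
theorem second_eq (h : IsReducedSolutionOn J a b c p q) (hJ : Convex ℝ J) {s t : ℝ} (hs : s ∈ J)
    (ht : t ∈ J) :
    a t * b t * (1 - p t) ^ 2 + b t * c t * (1 - q t) ^ 2 + a t * c t * (1 - p t * q t) ^ 2 =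
      a s * b s * (1 - p s) ^ 2 + b s * c s * (1 - q s) ^ 2 + a s * c s * (1 - p s * q s) ^ 2 :=
  eq_of_hasDerivWithinAt_zero hJ (f := fun t => a t * b t * (1 - p t) ^ 2
      + b t * c t * (1 - q t) ^ 2 + a t * c t * (1 - p t * q t) ^ 2) (fun r hr => by
    have ha := h.deriv_a r hr
    have hb := h.deriv_b r hr
    have hc := h.deriv_c r hr
    have hp := h.deriv_p r hr
    have hq := h.deriv_q r hr
    refine ((((ha.mul hb).mul ((hp.const_sub 1).pow 2)).add
      ((hb.mul hc).mul ((hq.const_sub 1).pow 2))).add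
      ((ha.mul hc).mul (((hp.mul hq).const_sub 1).pow 2))).congr_deriv ?_
    simp only [Pi.mul_apply, Pi.pow_apply]
    push_cast
    ring) hs ht

/-- The third constant of motion. -/
theorem third_eq (h : IsReducedSolutionOn J a b c p q) (hJ : Convex ℝ J) {s t : ℝ} (hs : s ∈ J)
    (ht : t ∈ J) :
    a t * b t * c t * (1 - p t) ^ 2 * (1 - q t) ^ 2 =
      a s * b s * c s * (1 - p s) ^ 2 * (1 - q s) ^ 2 :=
  eq_of_hasDerivWithinAt_zero hJ
    (f := fun t => a t * b t * c t * (1 - p t) ^ 2 * (1 - q t) ^ 2) (fun r hr => by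
    have ha := h.deriv_a r hr
    have hb := h.deriv_b r hr
    have hc := h.deriv_c r hr
    have hp := h.deriv_p r hr
    have hq := h.deriv_q r hr
    refine ((((ha.mul hb).mul hc).mul ((hp.const_sub 1).pow 2)).mul
      ((hq.const_sub 1).pow 2)).congr_deriv ?_
    simp only [Pi.mul_apply, Pi.pow_apply]
    push_cast
    ring) hs ht

theorem monotoneOn_a (h : IsReducedSolutionOn J a b c p q) (hJ : Convex ℝ J)
    (hs : ∀ t ∈ J, SignPattern (a t) (b t) (c t) (p t) (q t)) : MonotoneOn a J :=
  monotoneOn_of_forall_hasDerivWithinAt hJ h.deriv_a fun t ht => by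
    obtain ⟨ha, hb, hc, hp, -, hq, -⟩ := hs t ht
    have : 0 ≤ -a t * p t * (b t + c t * q t) := by have := neg_pos.2 ha; positivity
    linarith

theorem antitoneOn_b (h : IsReducedSolutionOn J a b c p q) (hJ : Convex ℝ J)
    (hs : ∀ t ∈ J, SignPattern (a t) (b t) (c t) (p t) (q t)) : AntitoneOn b J :=
  antitoneOn_of_forall_hasDerivWithinAt hJ h.deriv_b fun t ht => by
    obtain ⟨ha, hb, hc, hp, -, hq, -⟩ := hs t ht
    have : 0 ≤ b t * (-a t * p t + c t * q t) := by have := neg_pos.2 ha; positivity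
    linarith

theorem antitoneOn_p (h : IsReducedSolutionOn J a b c p q) (hJ : Convex ℝ J)
    (hs : ∀ t ∈ J, SignPattern (a t) (b t) (c t) (p t) (q t)) : AntitoneOn p J :=
  antitoneOn_of_forall_hasDerivWithinAt hJ h.deriv_p fun t ht => by
    obtain ⟨ha, hb, hc, hp, hp1, hq, -⟩ := hs t ht
    have : 0 ≤ p t * (1 - p t) * (-a t + b t + c t * q t) := by
      have := neg_pos.2 ha
      have := sub_pos.2 hp1
      positivity
    linarith

/-- The asymptotics of three peakons in the reduced variables. -/
theorem exists_tendsto (h : IsReducedSolutionOn (Ici 0) a b c p q)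
    (h0 : SignPattern (a 0) (b 0) (c 0) (p 0) (q 0)) :
    ∃ α β γ : ℝ, α < 0 ∧ 0 < β ∧ β < γ ∧ Tendsto a atTop (𝓝 α) ∧ Tendsto b atTop (𝓝 β) ∧
      Tendsto c atTop (𝓝 γ) ∧ Tendsto p atTop (𝓝 0) ∧ Tendsto q atTop (𝓝 0) := by
  have hs := h.signPattern_Ici h0
  have hconv := convex_Ici (𝕜 := ℝ) (0 : ℝ)
  have hmem0 : (0 : ℝ) ∈ Ici (0 : ℝ) := self_mem_Ici
  have hev : ∀ᶠ t : ℝ in atTop, t ∈ Ici (0 : ℝ) := eventually_ge_atTop 0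
  have hamono := h.monotoneOn_a hconv hs
  have hbanti := h.antitoneOn_b hconv hs
  have hpanti := h.antitoneOn_p hconv hs
  obtain ⟨α, hα, -, hα0⟩ := exists_tendsto_of_monotoneOn_Ici hamono (B := 0)
    fun t ht => (hs t ht).a_neg.le
  obtain ⟨β', hβ', hβ'le, hβ'0⟩ := exists_tendsto_of_monotoneOn_Ici hbanti.neg (B := 0)
    fun t ht => by simpa using (hs t ht).b_pos.le
  obtain ⟨β, rfl⟩ : ∃ β, β' = -β := ⟨-β', (neg_neg _).symm⟩
  have hβ : Tendsto b atTop (𝓝 β) := by simpa using hβ'.neg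
  have hβle : ∀ t ∈ Ici (0 : ℝ), β ≤ b t := fun t ht => by simpa using hβ'le t ht
  have hβ0 : 0 ≤ β := by simpa using hβ'0
  obtain ⟨γ, hγ⟩ : ∃ γ, Tendsto c atTop (𝓝 γ) := by
    refine ⟨(a 0 + b 0 + c 0) - α - β, ((tendsto_const_nhds.sub hα).sub hβ).congr' ?_⟩
    filter_upwards [hev] with t ht
    rw [← h.sum_eq hconv hmem0 ht]
    ring
  have hγ0 : 0 ≤ γ := ge_of_tendsto hγ (hev.mono fun t ht => (hs t ht).c_pos.le)
  -- the limits do not vanish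
  set M := a 0 * b 0 * c 0 * (1 - p 0) ^ 2 * (1 - q 0) ^ 2 with hM
  have hM0 : M < 0 := by
    obtain ⟨ha, hb, hc, -, hp, -, hq⟩ := h0
    have h1 := sub_pos.2 hp
    have h2 := sub_pos.2 hq
    have : 0 < -a 0 * b 0 * c 0 * (1 - p 0) ^ 2 * (1 - q 0) ^ 2 := by
      have := neg_pos.2 ha; positivity
    linarith
  have hMt : ∀ t ∈ Ici (0 : ℝ), a t * b t * c t * (1 - p t) ^ 2 * (1 - q t) ^ 2 = M :=
    fun t ht => h.third_eq hconv hmem0 ht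
  -- The factors $(1-p)^2(1-q)^2$ are at most $1$ and $abc<0$, so $abc\le M$ at all times. A
  -- strictly negative limit product rules out each zero limit.
  have hprod : α * β * γ ≤ M := by
    refine le_of_tendsto ((hα.mul hβ).mul hγ) (hev.mono fun t ht => ?_)
    have hst := hs t ht
    have h1 := sub_pos.2 hst.p_lt
    have h2 := sub_pos.2 hst.q_lt
    have h3 : 0 < -a t * b t * c t := by
      have := neg_pos.2 hst.a_neg; have := hst.b_pos; have := hst.c_pos; positivity
    have h4 : (1 - p t) ^ 2 * (1 - q t) ^ 2 ≤ 1 :=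
      mul_le_one₀ (pow_le_one₀ h1.le (by linarith [hst.p_pos])) (sq_nonneg _)
        (pow_le_one₀ h2.le (by linarith [hst.q_pos]))
    rw [← hMt t ht]
    nlinarith
  have hprod0 : α * β * γ < 0 := hprod.trans_lt hM0
  have hα_neg : α < 0 := lt_of_le_of_ne hα0 fun h => by simp [h] at hprod0
  have hβ_pos : 0 < β := lt_of_le_of_ne hβ0 fun h => by simp [← h] at hprod0
  have hγ_pos : 0 < γ := lt_of_le_of_ne hγ0 fun h => by simp [← h] at hprod0
  -- exponential decay of `p`
  set δ := (1 - p 0) * β with hδ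
  -- Since $p\le p(0)$ and $b\ge\beta$, the equation for $p$ gives $\dot p\le-\delta p$.
  have hδ_pos : 0 < δ := mul_pos (sub_pos.2 h0.p_lt) hβ_pos
  have hpexp : ∀ t ∈ Ici (0 : ℝ), p t ≤ Real.exp (-(δ * t)) := by
    have hanti : AntitoneOn (fun t => p t * Real.exp (δ * t)) (Ici 0) := by
      refine antitoneOn_of_forall_hasDerivWithinAt hconv (fun t ht => (h.deriv_p t ht).mul
        (((hasDerivAt_id t).const_mul δ).exp).hasDerivWithinAt) fun t ht => ?_
      obtain ⟨ha, hb, hc, hp, hp1, hq, -⟩ := hs t ht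
      have h1 : p t ≤ p 0 := hpanti hmem0 ht ht
      have h2 : δ ≤ (1 - p t) * (-a t + b t + c t * q t) := by
        refine mul_le_mul (by linarith) ?_ hβ0 (by linarith)
        have := hβle t ht
        have := mul_pos hc hq
        linarith
      have h3 : 0 < p t * Real.exp (δ * t) := by positivity
      have h4 := mul_le_mul_of_nonneg_left h2 h3.le
      simp only [id]
      linarith
    intro t ht
    have h1 := hanti hmem0 ht ht
    simp only [mul_zero, Real.exp_zero, mul_one] at h1
    rw [Real.exp_neg, ← one_div, le_div_iff₀ (Real.exp_pos _)]
    exact h1.trans h0.p_lt.le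
  have hexp0 : Tendsto (fun t : ℝ => Real.exp (-(δ * t))) atTop (𝓝 0) :=
    Real.tendsto_exp_neg_atTop_nhds_zero.comp (tendsto_id.const_mul_atTop hδ_pos)
  have hp0 : Tendsto p atTop (𝓝 0) :=
    tendsto_of_tendsto_of_tendsto_of_le_of_le' tendsto_const_nhds hexp0
      (hev.mono fun t ht => (hs t ht).p_pos.le) (hev.mono hpexp)
  -- decay of `q`
  have hq0 : Tendsto q atTop (𝓝 0) := by
    -- The third constant of motion is solved for $q$; the root is unambiguous because $1-q>0$.
    have hqlim : Tendsto q atTop (𝓝 (1 - √(M / (α * β * γ * (1 - 0) ^ 2)))) := by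
      have hne : α * β * γ * (1 - 0) ^ 2 ≠ 0 := by simpa using hprod0.ne
      refine (tendsto_const_nhds.sub ((tendsto_const_nhds.div (((hα.mul hβ).mul hγ).mul
        ((tendsto_const_nhds.sub hp0).pow 2)) hne).sqrt)).congr' ?_
      filter_upwards [hev] with t ht
      have hst := hs t ht
      have h1 := sub_pos.2 hst.p_lt
      have h2 := sub_pos.2 hst.q_lt
      have h3 := hst.a_neg.ne
      have h4 := hst.b_pos.ne'
      have h5 := hst.c_pos.ne'
      rw [Pi.div_apply, ← hMt t ht, mul_div_cancel_left₀ _ (by positivity), Real.sqrt_sq h2.le]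
      ring
    set r := 1 - √(M / (α * β * γ * (1 - 0) ^ 2))
    -- Here $\dot b\to-2\beta\gamma r$, and since $b$ converges this limit is zero, hence $r=0$.
    have hzero := eq_zero_of_tendsto_of_tendsto_hasDerivWithinAt h.deriv_b
      (((hβ.const_mul 2)).mul ((hα.mul hp0).sub (hγ.mul hqlim))) hβ
    have : r = 0 := by
      have h1 : β * (γ * r) = 0 := by linarith
      simpa [hβ_pos.ne', hγ_pos.ne'] using h1
    rwa [this] at hqlim
  -- the last two limits are different
  refine ⟨α, β, γ, hα_neg, hβ_pos, ?_, hα, hβ, hγ, hp0, hq0⟩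
  by_contra! hγβ
  obtain ⟨T, hT⟩ : ∃ T, ∀ t ≥ T, 0 ≤ t ∧ 0 < 2 * b t + a t * p t := by
    have h1 : Tendsto (fun t => 2 * b t + a t * p t) atTop (𝓝 (2 * β + α * 0)) :=
      (hβ.const_mul 2).add (hα.mul hp0)
    exact eventually_atTop.1 (hev.and (h1.eventually_const_lt (by linarith)))
  have hsub : Ici T ⊆ Ici 0 := fun t ht => (hT t ht).1
  have hT' := h.mono hsub
  -- The derivative of $b-c$ is $2abp-2cq(2b+ap)$, nonpositive after `T`. A nonincreasing function
  -- stays above its limit $\beta-\gamma\ge0$.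
  have hbc : ∀ t ∈ Ici T, 0 ≤ b t - c t := by
    have hanti : AntitoneOn (fun t => b t - c t) (Ici T) := by
      refine antitoneOn_of_forall_hasDerivWithinAt (convex_Ici T)
        (fun t ht => (hT'.deriv_b t ht).sub (hT'.deriv_c t ht)) fun t ht => ?_
      obtain ⟨ha, hb, hc, hp, hp1, hq, -⟩ := hs t (hsub ht)
      have h1 : 0 ≤ b t * (-a t) * p t := by have := neg_pos.2 ha; positivity
      have h2 : 0 ≤ c t * q t * (2 * b t + a t * p t) := by have := (hT t ht).2; positivity
      linarith
    intro t ht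
    have h1 : β - γ ≤ b t - c t := le_of_tendsto (hβ.sub hγ)
      ((eventually_ge_atTop t).mono fun s hst => hanti ht (le_trans (mem_Ici.1 ht) hst) hst)
    linarith
  -- Chosen so that $\dot e=-a(0)e^{-\delta t}$. Because $ap\ge a(0)e^{-\delta t}$ and $b\ge c$, the
  -- integrating factor $\exp(e)$ makes $q/(1-q)$ nondecreasing, while $e\to0$ and $q\to0$ send this
  -- positive quantity to zero.
  set e := fun t => a 0 / δ * Real.exp (-(δ * t)) with he
  have hde : ∀ t, HasDerivAt e (-(a 0 * Real.exp (-(δ * t)))) t := fun t => by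
    refine ((((hasDerivAt_id t).const_mul δ).neg.exp).const_mul (a 0 / δ)).congr_deriv ?_
    simp only [id, Pi.neg_apply]
    field_simp
  have hmono : MonotoneOn (fun t => q t / (1 - q t) * Real.exp (e t)) (Ici T) := by
    refine monotoneOn_of_forall_hasDerivWithinAt (convex_Ici T)
      (fun t ht => ((hT'.deriv_q t ht).div ((hT'.deriv_q t ht).const_sub 1)
        (sub_pos.2 (hs t (hsub ht)).q_lt).ne').mul (hde t).exp.hasDerivWithinAt) fun t ht => ?_
    obtain ⟨ha, hb, hc, hp, hp1, hq, hq1⟩ := hs t (hsub ht)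
    have h1 := sub_pos.2 hq1
    have h2 : a 0 * Real.exp (-(δ * t)) ≤ a t * p t := by
      have h3 : a 0 ≤ a t := hamono hmem0 (hsub ht) (hsub ht)
      have h4 := hpexp t (hsub ht)
      nlinarith
    have h3 := hbc t ht
    have h4 : 0 ≤ q t / (1 - q t) * Real.exp (e t) *
        (a t * p t + b t - c t - a 0 * Real.exp (-(δ * t))) :=
      mul_nonneg (by positivity) (by linarith)
    refine h4.trans_eq ?_
    simp only [Pi.div_apply]
    field_simp
    ring
  have hlim : Tendsto (fun t => q t / (1 - q t) * Real.exp (e t)) atTop (𝓝 0) := by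
    have h1 : Tendsto e atTop (𝓝 (a 0 / δ * 0)) := hexp0.const_mul _
    simpa using (hq0.div (tendsto_const_nhds.sub hq0) (by simp)).mul
      ((Real.continuous_exp.tendsto _).comp h1)
  have hle : q T / (1 - q T) * Real.exp (e T) ≤ 0 := ge_of_tendsto hlim
    ((eventually_ge_atTop T).mono fun t ht => hmono self_mem_Ici ht ht)
  have hsT := hs T (hsub self_mem_Ici)
  have := sub_pos.2 hsT.q_lt
  have := hsT.q_pos
  exact absurd hle (not_le.2 (by positivity))

end IsReducedSolutionOn

end Peakon

namespace Peakon

/-! ### The three-peakon system in the ordered sector -/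

/-- A smooth vector field which agrees with the three-peakon system on the ordered sector. -/
def sectorField (w : (Fin 3 → ℝ) × (Fin 3 → ℝ)) : (Fin 3 → ℝ) × (Fin 3 → ℝ) :=
  (![w.2 0 + w.2 1 * Real.exp (w.1 0 - w.1 1)
        + w.2 2 * Real.exp (w.1 0 - w.1 1) * Real.exp (w.1 1 - w.1 2),
      w.2 0 * Real.exp (w.1 0 - w.1 1) + w.2 1 + w.2 2 * Real.exp (w.1 1 - w.1 2),
      w.2 0 * Real.exp (w.1 0 - w.1 1) * Real.exp (w.1 1 - w.1 2)
        + w.2 1 * Real.exp (w.1 1 - w.1 2) + w.2 2],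
    ![-(2 * w.2 0 * Real.exp (w.1 0 - w.1 1) * (w.2 1 + w.2 2 * Real.exp (w.1 1 - w.1 2))),
      2 * w.2 1 * (w.2 0 * Real.exp (w.1 0 - w.1 1) - w.2 2 * Real.exp (w.1 1 - w.1 2)),
      2 * w.2 2 * Real.exp (w.1 1 - w.1 2) * (w.2 0 * Real.exp (w.1 0 - w.1 1) + w.2 1)])

theorem contDiff_sectorField : ContDiff ℝ 1 sectorField := by
  refine ContDiff.prodMk ?_ ?_ <;> refine contDiff_pi.2 fun k => ?_ <;> fin_cases k <;>
    simp only [Fin.zero_eta, Fin.mk_one, Fin.reduceFinMk, Matrix.cons_val] <;> fun_prop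

theorem velocity_massRate_eq_sectorField {x : Fin 3 → ℝ} (hx : StrictMono x) (m : Fin 3 → ℝ)
    (k : Fin 3) :
    velocity x m k = (sectorField (x, m)).1 k ∧ massRate x m k = (sectorField (x, m)).2 k := by
  have h01 : x 0 < x 1 := hx (by decide)
  have h12 : x 1 < x 2 := hx (by decide)
  have h02 : x 0 < x 2 := h01.trans h12
  have e02 : Real.exp (x 0 - x 2) = Real.exp (x 0 - x 1) * Real.exp (x 1 - x 2) := by
    rw [← Real.exp_add]; ring_nf
  fin_cases k <;>
    simp only [velocity, massRate, sectorField, Fin.sum_univ_three, Fin.zero_eta, Fin.mk_one,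
      Fin.reduceFinMk, Matrix.cons_val, sub_self, abs_zero, neg_zero, Real.exp_zero,
      sign_neg (sub_neg.2 h01), sign_neg (sub_neg.2 h12), sign_neg (sub_neg.2 h02),
      sign_pos (sub_pos.2 h01), sign_pos (sub_pos.2 h12), sign_pos (sub_pos.2 h02), sign_zero,
      abs_of_neg (sub_neg.2 h01), abs_of_neg (sub_neg.2 h12), abs_of_neg (sub_neg.2 h02),
      abs_of_pos (sub_pos.2 h01), abs_of_pos (sub_pos.2 h12), abs_of_pos (sub_pos.2 h02),
      neg_sub, e02, SignType.coe_neg, SignType.coe_one, SignType.coe_zero] <;>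
    constructor <;> ring

variable {J : Set ℝ} {x m : ℝ → Fin 3 → ℝ}

theorem IsSolutionOn.hasDerivWithinAt_sectorField (h : IsSolutionOn J x m) {t : ℝ} (ht : t ∈ J) :
    HasDerivWithinAt (fun s => (x s, m s)) (sectorField (x t, m t)) J t :=
  (hasDerivWithinAt_pi.2 fun k => (h.position t ht k).congr_deriv
    (velocity_massRate_eq_sectorField (h.ordered t ht) (m t) k).1).prodMk
  (hasDerivWithinAt_pi.2 fun k => (h.mass t ht k).congr_deriv
    (velocity_massRate_eq_sectorField (h.ordered t ht) (m t) k).2)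

theorem isSolutionOn_of_hasDerivWithinAt_sectorField {w : ℝ → (Fin 3 → ℝ) × (Fin 3 → ℝ)}
    (hw : ∀ t ∈ J, HasDerivWithinAt w (sectorField (w t)) J t)
    (hord : ∀ t ∈ J, StrictMono (w t).1) :
    IsSolutionOn J (fun t => (w t).1) (fun t => (w t).2) where
  ordered := hord
  position t ht k := by
    rw [(velocity_massRate_eq_sectorField (hord t ht) (w t).2 k).1]
    exact hasDerivWithinAt_pi.1 (hw t ht).fst k
  mass t ht k := by
    rw [(velocity_massRate_eq_sectorField (hord t ht) (w t).2 k).2]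
    exact hasDerivWithinAt_pi.1 (hw t ht).snd k

theorem IsSolutionOn.eqOn_Ici {y p : ℝ → Fin 3 → ℝ} (h : IsSolutionOn (Ici 0) x m)
    (h' : IsSolutionOn (Ici 0) y p) (hx : y 0 = x 0) (hm : p 0 = m 0) :
    EqOn y x (Ici 0) ∧ EqOn p m (Ici 0) := by
  have := eqOn_Ici_of_hasDerivWithinAt contDiff_sectorField
    (fun t ht => h'.hasDerivWithinAt_sectorField ht)
    (fun t ht => h.hasDerivWithinAt_sectorField ht) (by rw [hx, hm])
  exact ⟨fun t ht => congrArg Prod.fst (this ht), fun t ht => congrArg Prod.snd (this ht)⟩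

theorem isReducedSolutionOn_of_hasDerivWithinAt_sectorField
    {w : ℝ → (Fin 3 → ℝ) × (Fin 3 → ℝ)}
    (hw : ∀ t ∈ J, HasDerivWithinAt w (sectorField (w t)) J t) :
    IsReducedSolutionOn J (fun t => (w t).2 0) (fun t => (w t).2 1) (fun t => (w t).2 2)
      (fun t => Real.exp ((w t).1 0 - (w t).1 1)) (fun t => Real.exp ((w t).1 1 - (w t).1 2)) := by
  have hx := fun t ht => hasDerivWithinAt_pi.1 (hw t ht).fst
  have hm := fun t ht => hasDerivWithinAt_pi.1 (hw t ht).snd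
  refine ⟨fun t ht => hm t ht 0, fun t ht => hm t ht 1, fun t ht => hm t ht 2,
    fun t ht => ((hx t ht 0).sub (hx t ht 1)).exp.congr_deriv ?_,
    fun t ht => ((hx t ht 1).sub (hx t ht 2)).exp.congr_deriv ?_⟩ <;>
  simp only [sectorField, Matrix.cons_val, Pi.sub_apply] <;> ring

theorem strictMono_of_exp_sub_lt_one {y : Fin 3 → ℝ} (h01 : Real.exp (y 0 - y 1) < 1)
    (h12 : Real.exp (y 1 - y 2) < 1) : StrictMono y := by
  rw [Real.exp_lt_one_iff, sub_neg] at h01 h12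
  refine Fin.strictMono_iff_lt_succ.2 fun i => ?_
  fin_cases i
  · exact h01
  · exact h12

theorem signPattern_of_strictMono {y p : Fin 3 → ℝ} (hy : StrictMono y) (h0 : p 0 < 0) (h1 : 0 < p 1)
    (h2 : 0 < p 2) :
    SignPattern (p 0) (p 1) (p 2) (Real.exp (y 0 - y 1)) (Real.exp (y 1 - y 2)) :=
  ⟨h0, h1, h2, Real.exp_pos _, Real.exp_lt_one_iff.2 (sub_neg.2 (hy (by decide))), Real.exp_pos _,
    Real.exp_lt_one_iff.2 (sub_neg.2 (hy (by decide)))⟩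

/-- An a priori bound for three peakons with masses of signs `(-++)`. -/
theorem norm_lt_of_hasDerivWithinAt_sectorField {w : ℝ → (Fin 3 → ℝ) × (Fin 3 → ℝ)} {T τ : ℝ}
    (hτ : τ ∈ Icc 0 T)
    (hw : ∀ t ∈ Icc 0 τ, HasDerivWithinAt w (sectorField (w t)) (Icc 0 τ) t)
    (hord : StrictMono (w 0).1) (h0 : (w 0).2 0 < 0) (h1 : 0 < (w 0).2 1) (h2 : 0 < (w 0).2 2) :
    ‖w τ‖ < ‖w 0‖ + (-(w 0).2 0 + 2 * (w 0).2 1 + (w 0).2 2) * (T + 2) := by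
  set B := -(w 0).2 0 + 2 * (w 0).2 1 + (w 0).2 2 with hB
  have hBpos : 0 < B := by linarith
  have hred := isReducedSolutionOn_of_hasDerivWithinAt_sectorField hw
  have hs := fun t ht => hred.signPattern_Icc (signPattern_of_strictMono hord h0 h1 h2) (t := t) ht
  have hmem0 : (0 : ℝ) ∈ Icc 0 τ := ⟨le_rfl, hτ.1⟩
  -- The left side is $\sum|m_i|$. It equals the conserved total mass minus $2a$, and $a$ increases.
  -- As $p,q<1$, it also bounds every velocity.
  have hmasses : ∀ t ∈ Icc 0 τ, -(w t).2 0 + (w t).2 1 + (w t).2 2 ≤ B := fun t ht => by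
    have ha := hred.monotoneOn_a (convex_Icc 0 τ) hs hmem0 ht ht.1
    have hb := hred.antitoneOn_b (convex_Icc 0 τ) hs hmem0 ht ht.1
    have hc := hred.sum_eq (convex_Icc 0 τ) hmem0 ht
    have := (hs t ht).a_neg
    have := (hs t ht).b_pos
    have := (hs t ht).c_pos
    linarith
  have hT : 0 ≤ T := hτ.1.trans hτ.2
  have hpos : ∀ k, ‖(w τ).1 k - (w 0).1 k‖ ≤ B * ‖τ - 0‖ := fun k =>
    (convex_Icc 0 τ).norm_image_sub_le_of_norm_hasDerivWithin_le
      (fun t ht => hasDerivWithinAt_pi.1 (hw t ht).fst k) (fun t ht => by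
        have hBt := hmasses t ht
        obtain ⟨ha, hb, hc, hp, hp1, hq, hq1⟩ := hs t ht
        have h3 := mul_pos hp hq
        have h4 : Real.exp ((w t).1 0 - (w t).1 1) * Real.exp ((w t).1 1 - (w t).1 2) < 1 :=
          mul_lt_one_of_nonneg_of_lt_one_left hp.le hp1 hq1.le
        rw [Real.norm_eq_abs, abs_le]
        fin_cases k <;>
          simp only [sectorField, Fin.zero_eta, Fin.mk_one, Fin.reduceFinMk, Matrix.cons_val] <;>
          constructor <;> nlinarith)
      hmem0 ⟨hτ.1, le_rfl⟩
  have hsτ := hs τ ⟨hτ.1, le_rfl⟩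
  have hBτ := hmasses τ ⟨hτ.1, le_rfl⟩
  have hab : ‖τ - 0‖ ≤ T := by rw [sub_zero, Real.norm_of_nonneg hτ.1]; exact hτ.2
  have hBT : 0 ≤ B * T := by positivity
  have hnn := norm_nonneg (w 0)
  rw [Prod.norm_def, max_lt_iff]
  constructor <;> refine (pi_norm_lt_iff (by nlinarith)).2 fun k => ?_
  · have h3 := hpos k
    have h4 : ‖(w 0).1 k‖ ≤ ‖w 0‖ := (norm_le_pi_norm _ k).trans (norm_fst_le _)
    have h5 := norm_sub_norm_le ((w τ).1 k) ((w 0).1 k)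
    nlinarith
  · obtain ⟨ha, hb, hc, -⟩ := hsτ
    have h6 : |(w τ).2 k| ≤ B := by
      rw [abs_le]
      fin_cases k <;> simp only [Fin.zero_eta, Fin.mk_one, Fin.reduceFinMk] <;>
        constructor <;> linarith
    rw [Real.norm_eq_abs]
    nlinarith

/-- Global existence, uniqueness and scattering of three peakons with initial data `(x₀, m₀)` on
the time set `J`, in the time direction `l`. -/
def HasScattering (x₀ m₀ : Fin 3 → ℝ) (J : Set ℝ) (l : Filter ℝ) : Prop :=
  ∃ x m : ℝ → Fin 3 → ℝ, IsSolutionOn J x m ∧ x 0 = x₀ ∧ m 0 = m₀ ∧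
    (∀ y p : ℝ → Fin 3 → ℝ, IsSolutionOn J y p → y 0 = x₀ → p 0 = m₀ →
      EqOn y x J ∧ EqOn p m J) ∧
    ∃ μ : Fin 3 → ℝ,
      (∀ i, Tendsto (fun t => m t i) l (𝓝 (μ i))) ∧
      (∀ i, Tendsto (fun t => velocity (x t) (m t) i) l (𝓝 (μ i))) ∧
      (∀ i, μ i ≠ 0) ∧ Function.Injective μ ∧
      (∀ i j, i < j → Tendsto (fun t => (x t j - x t i) / |t|) l (𝓝 |μ j - μ i|)) ∧
      ∀ t ∈ J, M₁ (m t) = μ 0 + μ 1 + μ 2 ∧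
        M₂ (x t) (m t) = μ 0 * μ 1 + μ 1 * μ 2 + μ 0 * μ 2 ∧ M₃ (x t) (m t) = μ 0 * μ 1 * μ 2

/-- Scattering of three peakons with masses of signs `(-++)` in positive time. -/
theorem hasScattering_of_neg_pos_pos {x₀ m₀ : Fin 3 → ℝ} (hx₀ : StrictMono x₀) (h0 : m₀ 0 < 0)
    (h1 : 0 < m₀ 1) (h2 : 0 < m₀ 2) : HasScattering x₀ m₀ (Ici 0) atTop := by
  obtain ⟨w, hw0, hw⟩ := exists_integralCurve_Ici_of_bound contDiff_sectorField (x₀, m₀)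
    (fun T => ‖(x₀, m₀)‖ + (-m₀ 0 + 2 * m₀ 1 + m₀ 2) * (T + 2)) fun T _ τ hτ w hw0 hw => by
      have := norm_lt_of_hasDerivWithinAt_sectorField hτ hw (by rwa [hw0]) (by rwa [hw0])
        (by rwa [hw0]) (by rwa [hw0])
      rwa [hw0] at this
  have hred := isReducedSolutionOn_of_hasDerivWithinAt_sectorField hw
  have hs0 := signPattern_of_strictMono hx₀ h0 h1 h2
  have hs := hred.signPattern_Ici (by simpa only [hw0] using hs0)
  have hord : ∀ t ∈ Ici (0 : ℝ), StrictMono (w t).1 := fun t ht =>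
    strictMono_of_exp_sub_lt_one (hs t ht).p_lt (hs t ht).q_lt
  have hsol := isSolutionOn_of_hasDerivWithinAt_sectorField hw hord
  have hx0 : (w 0).1 = x₀ := by rw [hw0]
  have hm0 : (w 0).2 = m₀ := by rw [hw0]
  obtain ⟨α, β, γ, hα, hβ, hβγ, ha, hb, hc, hp, hq⟩ :=
    hred.exists_tendsto (by simpa only [hw0] using hs0)
  have hev : ∀ᶠ t : ℝ in atTop, t ∈ Ici (0 : ℝ) := eventually_ge_atTop 0
  have hvel : ∀ i, Tendsto (fun t => velocity (w t).1 (w t).2 i) atTop (𝓝 (![α, β, γ] i)) := by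
    intro i
    refine Tendsto.congr' (hev.mono fun t ht =>
      (velocity_massRate_eq_sectorField (hord t ht) (w t).2 i).1.symm) ?_
    fin_cases i <;>
      simp only [sectorField, Fin.zero_eta, Fin.mk_one, Fin.reduceFinMk, Matrix.cons_val]
    · simpa using (ha.add (hb.mul hp)).add ((hc.mul hp).mul hq)
    · simpa using ((ha.mul hp).add hb).add (hc.mul hq)
    · simpa using (((ha.mul hp).mul hq).add (hb.mul hq)).add hc
  have hmono : StrictMono ![α, β, γ] := by
    refine Fin.strictMono_iff_lt_succ.2 fun i => ?_
    fin_cases i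
    · exact hα.trans hβ
    · exact hβγ
  refine ⟨fun t => (w t).1, fun t => (w t).2, hsol, hx0, hm0,
    fun y p hyp hy hp => hsol.eqOn_Ici hyp (hy.trans hx0.symm) (hp.trans hm0.symm),
    ![α, β, γ], fun i => ?_, hvel, fun i => ?_, hmono.injective, fun i j hij => ?_, fun t ht => ?_⟩
  · fin_cases i
    · exact ha
    · exact hb
    · exact hc
  · fin_cases i
    · exact hα.ne
    · exact hβ.ne'
    · exact (hβ.trans hβγ).ne'
  · rw [abs_of_pos (sub_pos.2 (hmono hij))]
    refine (tendsto_div_of_tendsto_hasDerivWithinAt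
      (fun t ht => (hsol.position t ht j).sub (hsol.position t ht i))
      ((hvel j).sub (hvel i))).congr' ?_
    filter_upwards [hev] with t ht
    rw [abs_of_nonneg (mem_Ici.1 ht), Pi.sub_apply]
  · have hconv := convex_Ici (𝕜 := ℝ) (0 : ℝ)
    have e02 : Real.exp ((w t).1 0 - (w t).1 2) =
        Real.exp ((w t).1 0 - (w t).1 1) * Real.exp ((w t).1 1 - (w t).1 2) := by
      rw [← Real.exp_add]; ring_nf
    simp only [M₁, M₂, M₃, e02, Matrix.cons_val]
    have hp1 := (tendsto_const_nhds (x := (1 : ℝ))).sub hp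
    have hq1 := (tendsto_const_nhds (x := (1 : ℝ))).sub hq
    refine ⟨?_, ?_, ?_⟩
    -- The value at time `t` is also the limit of the conserved expression as $s\to\infty$, where
    -- $p,q\to0$. The same argument gives the other two identities.
    · refine tendsto_nhds_unique (tendsto_const_nhds.congr' (hev.mono fun s hs => ?_))
        ((ha.add hb).add hc)
      exact (hred.sum_eq hconv ht hs).symm
    · have := (((ha.mul hb).mul (hp1.pow 2)).add ((hb.mul hc).mul (hq1.pow 2))).add
        ((ha.mul hc).mul (((tendsto_const_nhds (x := (1 : ℝ))).sub (hp.mul hq)).pow 2))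
      simp only [sub_zero, mul_zero, one_pow, mul_one] at this
      exact tendsto_nhds_unique (tendsto_const_nhds.congr' (hev.mono fun s hs =>
        (hred.second_eq hconv ht hs).symm)) this
    · have := (((ha.mul hb).mul hc).mul (hp1.pow 2)).mul (hq1.pow 2)
      simp only [sub_zero, one_pow, mul_one] at this
      exact tendsto_nhds_unique (tendsto_const_nhds.congr' (hev.mono fun s hs =>
        (hred.third_eq hconv ht hs).symm)) this

end Peakon

namespace Peakon

/-! ### Symmetries of the peakon system -/

section Symmetry

variable {n : ℕ}

theorem velocity_neg (x m : Fin n → ℝ) (k : Fin n) : velocity x (-m) k = -velocity x m k := by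
  simp [velocity, Finset.sum_neg_distrib]

theorem massRate_neg (x m : Fin n → ℝ) (k : Fin n) : massRate x (-m) k = massRate x m k := by
  simp [massRate, Finset.sum_neg_distrib]

/-- The reflection `v ↦ (-v_n, ..., -v_1)`. -/
def reflect (v : Fin n → ℝ) : Fin n → ℝ := fun i => -v i.rev

theorem reflect_reflect (v : Fin n → ℝ) : reflect (reflect v) = v := by
  ext i; simp [reflect]

theorem strictMono_reflect {v : Fin n → ℝ} (hv : StrictMono v) : StrictMono (reflect v) :=
  fun _ _ hij => neg_lt_neg (hv (Fin.rev_lt_rev.2 hij))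

theorem velocity_reflect (x m : Fin n → ℝ) (k : Fin n) :
    velocity (reflect x) (reflect m) k = -velocity x m k.rev := by
  rw [velocity, velocity, ← Finset.sum_neg_distrib, ← Equiv.sum_comp Fin.revPerm]
  refine Finset.sum_congr rfl fun i _ => ?_
  rw [Fin.revPerm_apply, reflect, reflect, reflect, Fin.rev_rev, neg_sub_neg, abs_sub_comm]
  ring

theorem massRate_reflect (x m : Fin n → ℝ) (k : Fin n) :
    massRate (reflect x) (reflect m) k = -massRate x m k.rev := by
  have h : ∑ i, reflect m i * (SignType.sign (reflect x k - reflect x i) : ℝ) *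
      Real.exp (-|reflect x k - reflect x i|) = ∑ i, m i *
      (SignType.sign (x k.rev - x i) : ℝ) * Real.exp (-|x k.rev - x i|) := by
    rw [← Equiv.sum_comp Fin.revPerm]
    refine Finset.sum_congr rfl fun i _ => ?_
    rw [Fin.revPerm_apply, reflect, reflect, reflect, Fin.rev_rev, neg_sub_neg, abs_sub_comm,
      ← neg_sub (x k.rev), Left.sign_neg, SignType.coe_neg]
    ring
  rw [massRate, massRate, h, reflect]
  ring

variable {J J' : Set ℝ} {x m : ℝ → Fin n → ℝ}

theorem IsSolutionOn.timeReverse (h : IsSolutionOn J x m) (hJ : ∀ t ∈ J', -t ∈ J) :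
    IsSolutionOn J' (fun t => x (-t)) (fun t => -m (-t)) where
  ordered t ht := h.ordered _ (hJ t ht)
  position t ht k := by
    rw [velocity_neg]
    exact ((h.position _ (hJ t ht) k).scomp t (hasDerivAt_neg t).hasDerivWithinAt hJ).congr_deriv
      (by simp)
  mass t ht k := by
    rw [massRate_neg]
    exact (((h.mass _ (hJ t ht) k).scomp t (hasDerivAt_neg t).hasDerivWithinAt hJ).neg).congr_deriv
      (by simp)

theorem IsSolutionOn.reflect (h : IsSolutionOn J x m) :
    IsSolutionOn J (fun t => reflect (x t)) (fun t => reflect (m t)) where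
  ordered t ht := strictMono_reflect (h.ordered t ht)
  position t ht k := by
    rw [velocity_reflect]
    exact (h.position t ht k.rev).neg
  mass t ht k := by
    rw [massRate_reflect]
    exact (h.mass t ht k.rev).neg

end Symmetry

theorem M₂_reflect (x m : Fin 3 → ℝ) : M₂ (reflect x) (reflect m) = M₂ x m := by
  have h0 : (0 : Fin 3).rev = 2 := rfl
  have h1 : (1 : Fin 3).rev = 1 := rfl
  have h2 : (2 : Fin 3).rev = 0 := rfl
  simp only [M₂, reflect, h0, h1, h2, neg_sub_neg]
  ring

theorem M₃_reflect (x m : Fin 3 → ℝ) : M₃ (reflect x) (reflect m) = -M₃ x m := by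
  have h0 : (0 : Fin 3).rev = 2 := rfl
  have h1 : (1 : Fin 3).rev = 1 := rfl
  have h2 : (2 : Fin 3).rev = 0 := rfl
  simp only [M₃, reflect, h0, h1, h2, neg_sub_neg]
  ring

theorem M₁_reflect (m : Fin 3 → ℝ) : M₁ (reflect m) = -M₁ m := by
  have h0 : (0 : Fin 3).rev = 2 := rfl
  have h1 : (1 : Fin 3).rev = 1 := rfl
  have h2 : (2 : Fin 3).rev = 0 := rfl
  simp only [M₁, reflect, h0, h1, h2]
  ring

theorem HasScattering.timeReverse {x₀ m₀ : Fin 3 → ℝ}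
    (h : HasScattering x₀ (-m₀) (Ici 0) atTop) : HasScattering x₀ m₀ (Iic 0) atBot := by
  obtain ⟨x, m, hsol, hx, hm, huniq, μ, hμm, hμv, hμ0, hinj, hsep, hM⟩ := h
  have hJ : ∀ t ∈ Iic (0 : ℝ), -t ∈ Ici (0 : ℝ) := fun t ht => neg_nonneg.2 (mem_Iic.1 ht)
  have hJ' : ∀ t ∈ Ici (0 : ℝ), -t ∈ Iic (0 : ℝ) := fun t ht => neg_nonpos.2 (mem_Ici.1 ht)
  refine ⟨fun t => x (-t), fun t => -m (-t), hsol.timeReverse hJ, by simpa using hx, by simp [hm],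
    fun y p hyp hy hp => ?_, -μ, fun i => ?_, fun i => ?_, fun i => ?_, ?_, fun i j hij => ?_,
    fun t ht => ?_⟩
  · obtain ⟨h1, h2⟩ := huniq _ _ (hyp.timeReverse hJ') (by simpa using hy) (by simp [hp])
    refine ⟨fun t ht => ?_, fun t ht => ?_⟩
    · simpa using h1 (hJ t ht)
    · simpa using congrArg Neg.neg (h2 (hJ t ht))
  · exact ((hμm i).comp tendsto_neg_atBot_atTop).neg
  · simp only [velocity_neg]
    exact ((hμv i).comp tendsto_neg_atBot_atTop).neg
  · exact neg_ne_zero.2 (hμ0 i)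
  · exact neg_injective.comp hinj
  · have := (hsep i j hij).comp tendsto_neg_atBot_atTop
    rw [← abs_neg, neg_sub'] at this
    simpa only [Function.comp_def, abs_neg, Pi.neg_apply] using this
  · obtain ⟨h1, h2, h3⟩ := hM _ (hJ t ht)
    simp only [M₁, M₂, M₃, Pi.neg_apply] at *
    exact ⟨by linarith, by linarith, by linarith⟩

theorem HasScattering.reflect {x₀ m₀ : Fin 3 → ℝ} {J : Set ℝ} {l : Filter ℝ}
    (h : HasScattering (reflect x₀) (reflect m₀) J l) : HasScattering x₀ m₀ J l := by
  obtain ⟨x, m, hsol, hx, hm, huniq, μ, hμm, hμv, hμ0, hinj, hsep, hM⟩ := h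
  refine ⟨_, _, hsol.reflect, by rw [hx, reflect_reflect], by rw [hm, reflect_reflect],
    fun y p hyp hy hp => ?_, Peakon.reflect μ, fun i => (hμm i.rev).neg, fun i => ?_,
    fun i => neg_ne_zero.2 (hμ0 _), fun i j hij => Fin.rev_injective (hinj (neg_injective hij)),
    fun i j hij => ?_, fun t ht => ?_⟩
  · obtain ⟨h1, h2⟩ := huniq _ _ hyp.reflect (by rw [hy]) (by rw [hp])
    refine ⟨fun t ht => ?_, fun t ht => ?_⟩
    · change y t = Peakon.reflect (x t)
      rw [← h1 ht, reflect_reflect]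
    · change p t = Peakon.reflect (m t)
      rw [← h2 ht, reflect_reflect]
  · simp only [velocity_reflect]
    exact (hμv i.rev).neg
  · simpa only [Peakon.reflect, neg_sub_neg] using hsep j.rev i.rev (Fin.rev_lt_rev.2 hij)
  · obtain ⟨h1, h2, h3⟩ := hM t ht
    have e0 : (0 : Fin 3).rev = 2 := rfl
    have e1 : (1 : Fin 3).rev = 1 := rfl
    have e2 : (2 : Fin 3).rev = 0 := rfl
    rw [M₁_reflect, M₂_reflect, M₃_reflect, h1, h2, h3]
    simp only [Peakon.reflect, e0, e1, e2]
    exact ⟨by ring, by ring, by ring⟩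

/-- Scattering of three peakons in positive time, if the first mass is negative and the last one
is positive. -/
theorem hasScattering_atTop {x₀ m₀ : Fin 3 → ℝ} (hx₀ : StrictMono x₀)
    (h : (m₀ 0 < 0 ∧ 0 < m₀ 1 ∧ 0 < m₀ 2) ∨ (m₀ 0 < 0 ∧ m₀ 1 < 0 ∧ 0 < m₀ 2)) :
    HasScattering x₀ m₀ (Ici 0) atTop := by
  rcases h with ⟨h0, h1, h2⟩ | ⟨h0, h1, h2⟩
  · exact hasScattering_of_neg_pos_pos hx₀ h0 h1 h2
  -- Reversing the order and negating turns $(--+)$ into $(-++)$.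
  · exact (hasScattering_of_neg_pos_pos (strictMono_reflect hx₀) (neg_neg_of_pos h2)
      (neg_pos.2 h1) (neg_pos.2 h0)).reflect

/-- Scattering of three peakons in negative time, if the first mass is positive and the last one
is negative. -/
theorem hasScattering_atBot {x₀ m₀ : Fin 3 → ℝ} (hx₀ : StrictMono x₀)
    (h : (0 < m₀ 0 ∧ 0 < m₀ 1 ∧ m₀ 2 < 0) ∨ (0 < m₀ 0 ∧ m₀ 1 < 0 ∧ m₀ 2 < 0)) :
    HasScattering x₀ m₀ (Iic 0) atBot :=
  -- Negation sends $(++-)$ to $(--+)$ and $(+--)$ to $(-++)$, so the two alternatives are swapped.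
  (hasScattering_atTop hx₀ (by simpa [or_comm] using h)).timeReverse

end Peakon

namespace Peakon

/-! ### Eigenfunctions are roots of the spectral polynomial -/

/-- The general solution of `Ψ' = Ψ'''`. -/
def expCombo (A B C : ℂ) (y : ℝ) : ℂ := A + B * (Real.exp y : ℂ) + C * (Real.exp (-y) : ℂ)

theorem hasDerivAt_ofReal_exp (y : ℝ) :
    HasDerivAt (fun s : ℝ => (Real.exp s : ℂ)) (Real.exp y : ℂ) y :=
  (Real.hasDerivAt_exp y).ofReal_comp

theorem hasDerivAt_ofReal_exp_neg (y : ℝ) :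
    HasDerivAt (fun s : ℝ => (Real.exp (-s) : ℂ)) (-(Real.exp (-y) : ℂ)) y := by
  simpa using ((hasDerivAt_neg y).exp).ofReal_comp

theorem ofReal_exp_mul_exp_neg (y : ℝ) : (Real.exp y : ℂ) * (Real.exp (-y) : ℂ) = 1 := by
  rw [← Complex.ofReal_mul, ← Real.exp_add]; simp

theorem continuous_expCombo (A B C : ℂ) : Continuous (expCombo A B C) := by
  unfold expCombo; fun_prop

/-- The jump condition relates the coefficients on both sides of a peakon. -/
theorem expCombo_jump {Ψ : ℝ → ℂ} {x : ℝ} {s A B C A' B' C' L R : ℂ}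
    (hΨ : ContDiff ℝ 1 Ψ) (hL : Tendsto (deriv (deriv Ψ)) (𝓝[<] x) (𝓝 L))
    (hR : Tendsto (deriv (deriv Ψ)) (𝓝[>] x) (𝓝 R)) (hLR : -(R - L) = 2 * s)
    (hl : ∀ᶠ y in 𝓝[<] x, Ψ y = expCombo A B C y ∧ deriv Ψ y = expCombo 0 B (-C) y ∧
      deriv (deriv Ψ) y = expCombo 0 B C y)
    (hr : ∀ᶠ y in 𝓝[>] x, Ψ y = expCombo A' B' C' y ∧ deriv Ψ y = expCombo 0 B' (-C') y ∧
      deriv (deriv Ψ) y = expCombo 0 B' C' y) :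
    Ψ x = expCombo A B C x ∧ A' = A + 2 * s ∧ B' = B - s * (Real.exp (-x) : ℂ) ∧
      C' = C - s * (Real.exp x : ℂ) := by
  have hc0 := hΨ.continuous.tendsto x
  have hc1 := (hΨ.continuous_deriv le_rfl).tendsto x
  -- One-sided limits of $\Psi,\Psi',\Psi''$ at the peakon: the first two agree from both sides and
  -- the third jumps. This gives three linear equations for the new coefficients.
  have key : ∀ {f : ℝ → ℂ} {v : ℂ} {l : Filter ℝ} {a b c : ℂ} [l.NeBot], l ≤ 𝓝 x →
      Tendsto f l (𝓝 v) → (∀ᶠ y in l, f y = expCombo a b c y) → v = expCombo a b c x :=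
    fun hl hf he => tendsto_nhds_unique hf
      ((((continuous_expCombo _ _ _).tendsto x).mono_left hl).congr' (he.mono fun _ h => h.symm))
  have l0 := key nhdsWithin_le_nhds (hc0.mono_left nhdsWithin_le_nhds) (hl.mono fun _ h => h.1)
  have l1 := key nhdsWithin_le_nhds (hc1.mono_left nhdsWithin_le_nhds) (hl.mono fun _ h => h.2.1)
  have l2 := key nhdsWithin_le_nhds hL (hl.mono fun _ h => h.2.2)
  have r0 := key nhdsWithin_le_nhds (hc0.mono_left nhdsWithin_le_nhds) (hr.mono fun _ h => h.1)
  have r1 := key nhdsWithin_le_nhds (hc1.mono_left nhdsWithin_le_nhds) (hr.mono fun _ h => h.2.1)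
  have r2 := key nhdsWithin_le_nhds hR (hr.mono fun _ h => h.2.2)
  have he := ofReal_exp_mul_exp_neg x
  refine ⟨l0, ?_, ?_, ?_⟩ <;> rw [l0] at r0 <;> rw [l1] at r1 <;> rw [l2, r2] at hLR <;>
    simp only [expCombo] at r0 r1 hLR <;> set e := (Real.exp x : ℂ) <;>
    set e' := (Real.exp (-x) : ℂ)
  · linear_combination hLR - r0
  · linear_combination (B - B') * he - e' / 2 * hLR - e' / 2 * r1
  · linear_combination (C - C') * he - e / 2 * hLR + e / 2 * r1

/-- The equation $\Psi'=\Psi'''$ has the first integrals $\Psi-\Psi''$, $(\Psi''+\Psi')e^{-y}$ and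
$(\Psi''-\Psi')e^{y}$. On a connected set they are constant, and they determine the three
coefficients. -/
theorem exists_expCombo {Ψ : ℝ → ℂ} {U : Set ℝ} (hU : IsOpen U) (hUc : Convex ℝ U)
    (hΨ : ∀ y ∈ U, ContDiffAt ℝ 3 Ψ y ∧ deriv Ψ y - deriv (deriv (deriv Ψ)) y = 0) :
    ∃ A B C : ℂ, ∀ y ∈ U, Ψ y = expCombo A B C y ∧ deriv Ψ y = expCombo 0 B (-C) y ∧
      deriv (deriv Ψ) y = expCombo 0 B C y := by
  have h0 : ContDiffOn ℝ 3 Ψ U := fun y hy => (hΨ y hy).1.contDiffWithinAt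
  have h1 : ContDiffOn ℝ 2 (deriv Ψ) U := h0.deriv_of_isOpen hU (by norm_num)
  have h2 : ContDiffOn ℝ 1 (deriv (deriv Ψ)) U := h1.deriv_of_isOpen hU (by norm_num)
  have d0 : ∀ y ∈ U, HasDerivAt Ψ (deriv Ψ y) y := fun y hy =>
    ((h0.differentiableOn (by norm_num)).differentiableAt (hU.mem_nhds hy)).hasDerivAt
  have d1 : ∀ y ∈ U, HasDerivAt (deriv Ψ) (deriv (deriv Ψ) y) y := fun y hy =>
    ((h1.differentiableOn (by norm_num)).differentiableAt (hU.mem_nhds hy)).hasDerivAt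
  have d2 : ∀ y ∈ U, HasDerivAt (deriv (deriv Ψ)) (deriv Ψ y) y := fun y hy => by
    rw [sub_eq_zero.1 (hΨ y hy).2]
    exact ((h2.differentiableOn (by norm_num)).differentiableAt (hU.mem_nhds hy)).hasDerivAt
  have const : ∀ f : ℝ → ℂ, (∀ y ∈ U, HasDerivAt f 0 y) → ∃ a, ∀ y ∈ U, f y = a := fun f hf =>
    hU.exists_is_const_of_deriv_eq_zero hUc.isPreconnected
      (fun y hy => (hf y hy).differentiableAt.differentiableWithinAt) (fun y hy => (hf y hy).deriv)
  obtain ⟨A, hA⟩ := const (fun y => Ψ y - deriv (deriv Ψ) y) fun y hy =>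
    ((d0 y hy).sub (d2 y hy)).congr_deriv (sub_self _)
  obtain ⟨B, hB⟩ := const (fun y => (deriv (deriv Ψ) y + deriv Ψ y) * (Real.exp (-y) : ℂ))
    fun y hy => (((d2 y hy).add (d1 y hy)).mul (hasDerivAt_ofReal_exp_neg y)).congr_deriv (by
      simp only [Pi.add_apply]; ring)
  obtain ⟨C, hC⟩ := const (fun y => (deriv (deriv Ψ) y - deriv Ψ y) * (Real.exp y : ℂ))
    fun y hy => (((d2 y hy).sub (d1 y hy)).mul (hasDerivAt_ofReal_exp y)).congr_deriv (by
      simp only [Pi.sub_apply]; ring)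
  refine ⟨A, B / 2, C / 2, fun y hy => ?_⟩
  have hAy := hA y hy
  have hBy := hB y hy
  have hCy := hC y hy
  have he := ofReal_exp_mul_exp_neg y
  simp only [expCombo]
  set e := (Real.exp y : ℂ)
  set e' := (Real.exp (-y) : ℂ)
  refine ⟨?_, ?_, ?_⟩
  · linear_combination hAy + e / 2 * hBy + e' / 2 * hCy - deriv (deriv Ψ) y * he
  · linear_combination e / 2 * hBy - e' / 2 * hCy - deriv Ψ y * he
  · linear_combination e / 2 * hBy + e' / 2 * hCy - deriv (deriv Ψ) y * he

theorem tendsto_ofReal_exp_atBot : Tendsto (fun y : ℝ => (Real.exp y : ℂ)) atBot (𝓝 0) :=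
  (Complex.continuous_ofReal.tendsto' 0 0 Complex.ofReal_zero).comp Real.tendsto_exp_atBot

theorem tendsto_ofReal_exp_neg_atTop :
    Tendsto (fun y : ℝ => (Real.exp (-y) : ℂ)) atTop (𝓝 0) :=
  tendsto_ofReal_exp_atBot.comp tendsto_neg_atTop_atBot

/-- Multiplying $\Psi/e^y$ by $e^{2y}$ isolates $C$ in the limit; with $C=0$, multiplying by $e^y$
isolates $A$. -/
theorem expCombo_of_tendsto_atBot {Ψ : ℝ → ℂ} {A B C : ℂ}
    (hΨ : ∀ᶠ y in atBot, Ψ y = expCombo A B C y)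
    (hl : Tendsto (fun y => Ψ y / (Real.exp y : ℂ)) atBot (𝓝 1)) : A = 0 ∧ B = 1 ∧ C = 0 := by
  have hE := tendsto_ofReal_exp_atBot
  have hl' : Tendsto (fun y : ℝ => (A + B * (Real.exp y : ℂ) + C * (Real.exp (-y) : ℂ))
      * (Real.exp (-y) : ℂ)) atBot (𝓝 1) := by
    refine hl.congr' (hΨ.mono fun y hy => ?_)
    rw [hy, expCombo, div_eq_mul_inv]
    simp only [Real.exp_neg, Complex.ofReal_inv]
  have hC : C = 0 := by
    have h1 := (hl'.mul hE).mul hE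
    have h2 : Tendsto (fun y : ℝ => A * (Real.exp y : ℂ) + B * (Real.exp y : ℂ) * (Real.exp y : ℂ)
        + C) atBot (𝓝 (A * 0 + B * 0 * 0 + C)) :=
      ((hE.const_mul A).add ((hE.const_mul B).mul hE)).add_const C
    have h3 := tendsto_nhds_unique (h1.congr fun y => ?_) h2
    · simpa using h3.symm
    · have he := ofReal_exp_mul_exp_neg y
      set e := (Real.exp y : ℂ)
      set e' := (Real.exp (-y) : ℂ)
      linear_combination (A * e + B * e * e + C * (1 + e * e')) * he
  subst hC
  have hA : A = 0 := by
    have h2 : Tendsto (fun y : ℝ => A + B * (Real.exp y : ℂ)) atBot (𝓝 (A + B * 0)) :=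
      (hE.const_mul B).const_add A
    have h3 := tendsto_nhds_unique ((hl'.mul hE).congr fun y => ?_) h2
    · simpa using h3.symm
    · have he := ofReal_exp_mul_exp_neg y
      set e := (Real.exp y : ℂ)
      set e' := (Real.exp (-y) : ℂ)
      linear_combination (A + B * e) * he
  subst hA
  refine ⟨rfl, ?_, rfl⟩
  refine tendsto_nhds_unique (tendsto_const_nhds.congr fun y => ?_) hl'
  have he := ofReal_exp_mul_exp_neg y
  linear_combination (-B) * he

theorem expCombo_of_bounded_atTop {Ψ : ℝ → ℂ} {A B C : ℂ} {K : ℝ}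
    (hΨ : ∀ᶠ y in atTop, Ψ y = expCombo A B C y) (hK : ∀ᶠ y in atTop, ‖Ψ y‖ ≤ K) : B = 0 := by
  have hE := tendsto_ofReal_exp_neg_atTop
  have h1 : Tendsto (fun y : ℝ => Ψ y * (Real.exp (-y) : ℂ)) atTop (𝓝 0) :=
    isBoundedUnder_le_mul_tendsto_zero ⟨K, by simpa using hK⟩ hE
  have h2 : Tendsto (fun y : ℝ => A * (Real.exp (-y) : ℂ) + B
      + C * (Real.exp (-y) : ℂ) * (Real.exp (-y) : ℂ)) atTop (𝓝 (A * 0 + B + C * 0 * 0)) :=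
    ((hE.const_mul A).add_const B).add ((hE.const_mul C).mul hE)
  have h3 := tendsto_nhds_unique (h1.congr' (hΨ.mono fun y hy => ?_)) h2
  · simpa using h3.symm
  · have he := ofReal_exp_mul_exp_neg y
    rw [hy, expCombo]
    linear_combination B * he

/-- The value of `Ψ (x₂) / exp (x₂)` for the normalized solution `Ψ`. -/
def normalizedValue₁ (x m : Fin 3 → ℝ) (z : ℂ) : ℂ :=
  1 - z * m 0 * (1 - Real.exp (x 0) * Real.exp (-x 1)) ^ 2

/-- The value of `Ψ (x₃) / exp (x₃)` for the normalized solution `Ψ`. -/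
def normalizedValue₂ (x m : Fin 3 → ℝ) (z : ℂ) : ℂ :=
  1 - z * m 0 * (1 - Real.exp (x 0) * Real.exp (-x 2)) ^ 2
    - z * m 1 * normalizedValue₁ x m z * (1 - Real.exp (x 1) * Real.exp (-x 2)) ^ 2

/-- The right side is the coefficient of $e^y$ beyond the last peakon: each crossing subtracts
$z\,m_i\Psi(x_i)e^{-x_i}$ from the initial value $1$. -/
theorem eval_specPoly (x m : Fin 3 → ℝ) (z : ℂ) :
    (specPoly x m).eval z =
      1 - z * m 0 - z * m 1 * normalizedValue₁ x m z - z * m 2 * normalizedValue₂ x m z := by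
  simp only [specPoly, eval_sub, eval_add, eval_one, eval_mul, eval_C, eval_X, eval_pow, M₁, M₂,
    M₃, normalizedValue₁, normalizedValue₂, sub_eq_add_neg (x _), Real.exp_add]
  push_cast
  ring

theorem IsEigenfunction.isRoot {x m : Fin 3 → ℝ} (hx : StrictMono x) {z : ℂ} {Ψ : ℝ → ℂ}
    (h : IsEigenfunction x m z Ψ) : (specPoly x m).IsRoot z := by
  have h01 : x 0 < x 1 := hx (by decide)
  have h12 : x 1 < x 2 := hx (by decide)
  have hne : ∀ {y : ℝ}, y ≠ x 0 → y ≠ x 1 → y ≠ x 2 → ∀ i, y ≠ x i := fun h0 h1 h2 i => by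
    fin_cases i <;> assumption
  obtain ⟨A₀, B₀, C₀, H₀⟩ := exists_expCombo isOpen_Iio (convex_Iio (x 0)) fun y hy =>
    h.equation y (hne hy.ne (hy.trans h01).ne (hy.trans (h01.trans h12)).ne)
  obtain ⟨A₁, B₁, C₁, H₁⟩ := exists_expCombo isOpen_Ioo (convex_Ioo (x 0) (x 1)) fun y hy =>
    h.equation y (hne hy.1.ne' hy.2.ne (hy.2.trans h12).ne)
  obtain ⟨A₂, B₂, C₂, H₂⟩ := exists_expCombo isOpen_Ioo (convex_Ioo (x 1) (x 2)) fun y hy =>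
    h.equation y (hne (h01.trans hy.1).ne' hy.1.ne' hy.2.ne)
  obtain ⟨A₃, B₃, C₃, H₃⟩ := exists_expCombo isOpen_Ioi (convex_Ioi (x 2)) fun y hy =>
    h.equation y (hne ((h01.trans h12).trans hy).ne' (h12.trans hy).ne' (ne_of_gt hy))
  obtain ⟨K, hK⟩ := h.right
  obtain ⟨rfl, rfl, rfl⟩ := expCombo_of_tendsto_atBot
    ((eventually_lt_atBot (x 0)).mono fun y hy => (H₀ y hy).1) h.left
  obtain rfl := expCombo_of_bounded_atTop
    ((eventually_gt_atTop (x 2)).mono fun y hy => (H₃ y hy).1) hK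
  obtain ⟨L₀, R₀, hL₀, hR₀, hj₀⟩ := h.jump 0
  obtain ⟨L₁, R₁, hL₁, hR₁, hj₁⟩ := h.jump 1
  obtain ⟨L₂, R₂, hL₂, hR₂, hj₂⟩ := h.jump 2
  obtain ⟨v₀, rfl, rfl, rfl⟩ := expCombo_jump (s := z * m 0 * Ψ (x 0)) h.contDiff hL₀ hR₀
    (by rw [hj₀]; ring)
    (eventually_nhdsWithin_of_forall H₀) (eventually_of_mem (Ioo_mem_nhdsGT h01) H₁)
  obtain ⟨v₁, rfl, rfl, rfl⟩ := expCombo_jump (s := z * m 1 * Ψ (x 1)) h.contDiff hL₁ hR₁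
    (by rw [hj₁]; ring)
    (eventually_of_mem (Ioo_mem_nhdsLT h01) H₁) (eventually_of_mem (Ioo_mem_nhdsGT h12) H₂)
  -- The growing coefficient on the far right is already known to be zero, so `hB` becomes the
  -- equation $A(z)=0$ once the values of $\Psi$ at the peakons are inserted.
  obtain ⟨v₂, -, hB, -⟩ := expCombo_jump (s := z * m 2 * Ψ (x 2)) h.contDiff hL₂ hR₂
    (by rw [hj₂]; ring)
    (eventually_of_mem (Ioo_mem_nhdsLT h12) H₂) (eventually_nhdsWithin_of_forall H₃)
  have e0 := ofReal_exp_mul_exp_neg (x 0)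
  have e1 := ofReal_exp_mul_exp_neg (x 1)
  have e2 := ofReal_exp_mul_exp_neg (x 2)
  rw [IsRoot.def, eval_specPoly]
  have w₀ : Ψ (x 0) = Real.exp (x 0) := by rw [v₀, expCombo]; ring
  have w₁ : Ψ (x 1) = normalizedValue₁ x m z * Real.exp (x 1) := by
    rw [v₁, w₀, expCombo, normalizedValue₁]
    set E₀ := (Real.exp (x 0) : ℂ)
    set F₀ := (Real.exp (-x 0) : ℂ)
    set E₁ := (Real.exp (x 1) : ℂ)
    set F₁ := (Real.exp (-x 1) : ℂ)
    linear_combination (-(z * m 0 * E₁)) * e0 + z * m 0 * E₀ * (E₀ * F₁ - 2) * e1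
  have w₂ : Ψ (x 2) = normalizedValue₂ x m z * Real.exp (x 2) := by
    rw [v₂, w₁, w₀, expCombo, normalizedValue₂]
    set E₀ := (Real.exp (x 0) : ℂ)
    set F₀ := (Real.exp (-x 0) : ℂ)
    set E₁ := (Real.exp (x 1) : ℂ)
    set F₁ := (Real.exp (-x 1) : ℂ)
    set E₂ := (Real.exp (x 2) : ℂ)
    set F₂ := (Real.exp (-x 2) : ℂ)
    set φ := normalizedValue₁ x m z
    linear_combination (-(z * m 0 * E₂)) * e0 - z * m 1 * φ * E₂ * e1 +
      (z * m 0 * E₀ * (E₀ * F₂ - 2) + z * m 1 * φ * E₁ * (E₁ * F₂ - 2)) * e2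
  rw [w₀, w₁, w₂] at hB
  linear_combination -hB + z * m 0 * e0 + z * m 1 * normalizedValue₁ x m z * e1 +
    z * m 2 * normalizedValue₂ x m z * e2

end Peakon

namespace Peakon

/-! ### Roots of the spectral polynomial are eigenvalues -/

/-- The `C¹` solution of `h''' - h' = δ` supported on the right half-line. -/
def kernel (s : ℝ) : ℂ := if 0 < s then ((Real.cosh s - 1 : ℝ) : ℂ) else 0

/-- The derivative of `kernel`. -/
def kernel' (s : ℝ) : ℂ := if 0 < s then (Real.sinh s : ℂ) else 0

/-- The second derivative of `kernel` off the origin. -/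
def kernel'' (s : ℝ) : ℂ := if 0 < s then (Real.cosh s : ℂ) else 0

theorem eventuallyEq_ite_pos {f : ℝ → ℂ} {s : ℝ} (hs : s ≠ 0) :
    (fun r => if 0 < r then f r else 0) =ᶠ[𝓝 s] if 0 < s then f else fun _ => 0 := by
  rcases hs.lt_or_gt with h | h
  · filter_upwards [gt_mem_nhds h] with r hr
    rw [if_neg hr.not_gt, if_neg h.not_gt]
  · filter_upwards [lt_mem_nhds h] with r hr
    rw [if_pos hr, if_pos h]

/-- Off the origin one branch holds locally. At the origin the one-sided derivatives match when both
$f$ and $f'$ vanish there, which is the case for $\cosh-1$. -/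
theorem hasDerivAt_ite_pos {f f' : ℝ → ℂ} (hf : ∀ s, HasDerivAt f (f' s) s) {s : ℝ}
    (hs : s ≠ 0 ∨ f 0 = 0 ∧ f' 0 = 0) :
    HasDerivAt (fun r => if 0 < r then f r else 0) (if 0 < s then f' s else 0) s := by
  rcases ne_or_eq s 0 with h | rfl
  · refine HasDerivAt.congr_of_eventuallyEq ?_ (eventuallyEq_ite_pos h)
    split_ifs
    · exact hf s
    · exact hasDerivAt_const s 0
  · obtain ⟨h0, h1⟩ := hs.resolve_left (not_not.2 rfl)
    rw [if_neg (lt_irrefl _)]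
    have hl : HasDerivWithinAt (fun r => if 0 < r then f r else 0) 0 (Iic 0) 0 :=
      (hasDerivWithinAt_const (0 : ℝ) (Iic 0) (0 : ℂ)).congr
        (fun r hr => if_neg (not_lt.2 hr)) (if_neg (lt_irrefl _))
    have hr : HasDerivWithinAt (fun r => if 0 < r then f r else 0) 0 (Ici 0) 0 := by
      refine (h1 ▸ (hf 0).hasDerivWithinAt : HasDerivWithinAt f 0 (Ici 0) 0).congr
        (fun r hr => ?_) ?_
      · split_ifs with h
        · rfl
        · rw [le_antisymm (not_lt.1 h) hr, h0]
      · rw [if_neg (lt_irrefl _), h0]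
    simpa using hl.union hr

theorem hasDerivAt_ofReal_cosh (s : ℝ) :
    HasDerivAt (fun r : ℝ => (Real.cosh r : ℂ)) (Real.sinh s : ℂ) s :=
  (Real.hasDerivAt_cosh s).ofReal_comp

theorem hasDerivAt_ofReal_sinh (s : ℝ) :
    HasDerivAt (fun r : ℝ => (Real.sinh r : ℂ)) (Real.cosh s : ℂ) s :=
  (Real.hasDerivAt_sinh s).ofReal_comp

theorem hasDerivAt_kernel (s : ℝ) : HasDerivAt kernel (kernel' s) s :=
  hasDerivAt_ite_pos (fun s => ((Real.hasDerivAt_cosh s).sub_const 1).ofReal_comp)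
    (Or.inr (by simp))

theorem hasDerivAt_kernel' {s : ℝ} (hs : s ≠ 0) : HasDerivAt kernel' (kernel'' s) s :=
  hasDerivAt_ite_pos hasDerivAt_ofReal_sinh (Or.inl hs)

theorem hasDerivAt_kernel'' {s : ℝ} (hs : s ≠ 0) : HasDerivAt kernel'' (kernel' s) s :=
  hasDerivAt_ite_pos hasDerivAt_ofReal_cosh (Or.inl hs)

theorem continuous_kernel' : Continuous kernel' := by
  have : kernel' = fun s => (Real.sinh (max s 0) : ℂ) := by
    ext s
    rw [kernel']
    split_ifs with h
    · rw [max_eq_left h.le]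
    · rw [max_eq_right (not_lt.1 h), Real.sinh_zero, Complex.ofReal_zero]
  rw [this]
  fun_prop

theorem contDiffAt_kernel {s : ℝ} (hs : s ≠ 0) : ContDiffAt ℝ 3 kernel s := by
  refine ContDiffAt.congr_of_eventuallyEq ?_ (eventuallyEq_ite_pos hs)
  split_ifs
  · exact Complex.ofRealCLM.contDiff.contDiffAt.comp s
      (Real.contDiff_cosh.sub contDiff_const).contDiffAt
  · exact contDiffAt_const

theorem tendsto_kernel''_nhdsLT (s : ℝ) : Tendsto kernel'' (𝓝[<] s) (𝓝 (kernel'' s)) := by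
  rcases ne_or_eq s 0 with h | rfl
  · exact (hasDerivAt_kernel'' h).continuousAt.tendsto.mono_left nhdsWithin_le_nhds
  · refine tendsto_const_nhds.congr' (eventually_nhdsWithin_of_forall fun r hr => ?_)
    rw [kernel'', kernel'', if_neg (lt_irrefl _), if_neg (not_lt.2 (le_of_lt hr))]

theorem tendsto_kernel''_nhdsGT (s : ℝ) :
    Tendsto kernel'' (𝓝[>] s) (𝓝 (kernel'' s + if s = 0 then 1 else 0)) := by
  rcases ne_or_eq s 0 with h | rfl
  · rw [if_neg h, add_zero]
    exact (hasDerivAt_kernel'' h).continuousAt.tendsto.mono_left nhdsWithin_le_nhds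
  · rw [if_pos rfl, kernel'', if_neg (lt_irrefl _), zero_add]
    have h1 : Tendsto (fun r : ℝ => (Real.cosh r : ℂ)) (𝓝[>] 0) (𝓝 1) := by
      simpa using (hasDerivAt_ofReal_cosh 0).continuousAt.tendsto.mono_left
        (nhdsWithin_le_nhds (s := Ioi 0))
    refine h1.congr' (eventually_nhdsWithin_of_forall fun r hr => ?_)
    rw [kernel'', if_pos (mem_Ioi.1 hr)]

section EigenfunctionCandidate

variable {n : ℕ}

/-- The solution of `(∂ - ∂³) Ψ = 2 ∑ s_i δ_{x_i}` which equals `exp` near `-∞`. -/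
def peakonSolution (x : Fin n → ℝ) (s : Fin n → ℂ) (y : ℝ) : ℂ :=
  (Real.exp y : ℂ) - ∑ i, 2 * s i * kernel (y - x i)

variable (x : Fin n → ℝ) (s : Fin n → ℂ)

/-- As $e^y$ is its own derivative, this single rule serves for all three derivatives of the
candidate. -/
theorem hasDerivAt_exp_sub_sum {k k' : ℝ → ℂ} {y : ℝ}
    (hk : ∀ i, HasDerivAt k (k' (y - x i)) (y - x i)) :
    HasDerivAt (fun r : ℝ => (Real.exp r : ℂ) - ∑ i, 2 * s i * k (r - x i))
      ((Real.exp y : ℂ) - ∑ i, 2 * s i * k' (y - x i)) y :=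
  (hasDerivAt_ofReal_exp y).sub
    (HasDerivAt.fun_sum fun i _ => ((hk i).comp_sub_const y (x i)).const_mul (2 * s i))

theorem deriv_peakonSolution :
    deriv (peakonSolution x s) =
      fun y => (Real.exp y : ℂ) - ∑ i, 2 * s i * kernel' (y - x i) :=
  funext fun _ => (hasDerivAt_exp_sub_sum x s fun _ => hasDerivAt_kernel _).deriv

theorem deriv_deriv_peakonSolution {y : ℝ} (hy : ∀ i, y ≠ x i) :
    deriv (deriv (peakonSolution x s)) y =
      (Real.exp y : ℂ) - ∑ i, 2 * s i * kernel'' (y - x i) := by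
  rw [deriv_peakonSolution]
  exact (hasDerivAt_exp_sub_sum x s fun i => hasDerivAt_kernel' (sub_ne_zero.2 (hy i))).deriv

theorem eventually_forall_ne {y : ℝ} (hy : ∀ i, y ≠ x i) : ∀ᶠ r in 𝓝 y, ∀ i, r ≠ x i :=
  eventually_all.2 fun i => eventually_ne_nhds (hy i)

theorem eventually_nhdsNE_forall_ne (y : ℝ) : ∀ᶠ r in 𝓝[≠] y, ∀ i, r ≠ x i :=
  eventually_all.2 fun i => by
    rcases ne_or_eq y (x i) with h | rfl
    · exact (eventually_ne_nhds h).filter_mono nhdsWithin_le_nhds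
    · exact eventually_mem_nhdsWithin

variable {x s}

/-- The hypothesis `hs` makes the prescribed source strengths consistent with the solution they
generate, which is the jump condition. The left side of `h0` is the coefficient of $e^y$ on the far
right, so its vanishing gives boundedness. -/
theorem isEigenfunction_peakonSolution {m : Fin n → ℝ} {z : ℂ} (hx : StrictMono x)
    (hs : ∀ i, s i = z * m i * peakonSolution x s (x i))
    (h0 : 1 - ∑ i, s i * (Real.exp (-x i) : ℂ) = 0) :
    IsEigenfunction x m z (peakonSolution x s) where
  contDiff := by
    refine contDiff_one_iff_deriv.2
      ⟨fun y => (hasDerivAt_exp_sub_sum x s fun _ => hasDerivAt_kernel _).differentiableAt, ?_⟩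
    have := continuous_kernel'
    rw [deriv_peakonSolution]
    fun_prop
  equation y hy := by
    constructor
    · refine ContDiffAt.sub (Complex.ofRealCLM.contDiff.contDiffAt.comp y Real.contDiff_exp.contDiffAt)
        (ContDiffAt.sum fun i _ => contDiffAt_const.mul ?_)
      exact (contDiffAt_kernel (sub_ne_zero.2 (hy i))).comp y
        (contDiffAt_id.sub contDiffAt_const)
    · have h2 : deriv (deriv (peakonSolution x s)) =ᶠ[𝓝 y]
          fun r => (Real.exp r : ℂ) - ∑ i, 2 * s i * kernel'' (r - x i) :=
        (eventually_forall_ne x hy).mono fun r hr => deriv_deriv_peakonSolution x s hr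
      rw [h2.deriv_eq, deriv_peakonSolution, (hasDerivAt_exp_sub_sum x s fun i =>
        hasDerivAt_kernel'' (sub_ne_zero.2 (hy i))).deriv, sub_self]
  jump i := by
    have h2 : deriv (deriv (peakonSolution x s)) =ᶠ[𝓝[≠] (x i)]
        fun r => (Real.exp r : ℂ) - ∑ j, 2 * s j * kernel'' (r - x j) :=
      (eventually_nhdsNE_forall_ne x (x i)).mono fun r hr => deriv_deriv_peakonSolution x s hr
    have hexp : Tendsto (fun r : ℝ => (Real.exp r : ℂ)) (𝓝 (x i)) (𝓝 (Real.exp (x i))) :=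
      (hasDerivAt_ofReal_exp (x i)).continuousAt
    have hltsub : ∀ j, Tendsto (fun r => r - x j) (𝓝[<] (x i)) (𝓝[<] (x i - x j)) := fun j =>
      tendsto_nhdsWithin_iff.2
        ⟨((continuous_sub_right (x j)).tendsto (x i)).mono_left nhdsWithin_le_nhds,
          eventually_nhdsWithin_of_forall fun r hr => mem_Iio.2 (sub_lt_sub_right hr _)⟩
    have hgtsub : ∀ j, Tendsto (fun r => r - x j) (𝓝[>] (x i)) (𝓝[>] (x i - x j)) := fun j =>
      tendsto_nhdsWithin_iff.2
        ⟨((continuous_sub_right (x j)).tendsto (x i)).mono_left nhdsWithin_le_nhds,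
          eventually_nhdsWithin_of_forall fun r hr => mem_Ioi.2 (sub_lt_sub_right (mem_Ioi.1 hr) _)⟩
    refine ⟨_, _, Tendsto.congr' (h2.filter_mono (nhdsLT_le_nhdsNE _)).symm
      ((hexp.mono_left nhdsWithin_le_nhds).sub (tendsto_finsetSum _ fun j _ =>
        ((tendsto_kernel''_nhdsLT _).comp (hltsub j)).const_mul (2 * s j))),
      Tendsto.congr' (h2.filter_mono (nhdsGT_le_nhdsNE _)).symm
      ((hexp.mono_left nhdsWithin_le_nhds).sub (tendsto_finsetSum _ fun j _ =>
        ((tendsto_kernel''_nhdsGT _).comp (hgtsub j)).const_mul (2 * s j))), ?_⟩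
    simp only [mul_add, Finset.sum_add_distrib, sub_eq_zero, hx.injective.eq_iff, mul_ite, mul_one,
      mul_zero, Finset.sum_ite_eq, Finset.mem_univ, if_true]
    linear_combination 2 * hs i
  left := by
    have h : ∀ᶠ y in atBot, ∀ i, y ≤ x i := eventually_all.2 fun i => eventually_le_atBot (x i)
    refine tendsto_const_nhds.congr' (h.mono fun y hy => ?_)
    have hk : ∀ i, kernel (y - x i) = 0 := fun i => if_neg (not_lt.2 (sub_nonpos.2 (hy i)))
    simp [peakonSolution, hk]
  right := by
    have h : ∀ᶠ y in atTop, ∀ i, x i < y := eventually_all.2 fun i => eventually_gt_atTop (x i)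
    have hlim : Tendsto (peakonSolution x s) atTop
        (𝓝 (∑ i, 2 * s i - ∑ i, s i * (Real.exp (x i) : ℂ) * 0)) := by
      refine Tendsto.congr' (h.mono fun y hy => ?_) (tendsto_const_nhds.sub
        (tendsto_finsetSum _ fun i _ =>
          tendsto_ofReal_exp_neg_atTop.const_mul (s i * (Real.exp (x i) : ℂ))))
      have hk : ∀ i, 2 * s i * kernel (y - x i) = (Real.exp y : ℂ) * (s i * Real.exp (-x i)) +
          s i * Real.exp (x i) * Real.exp (-y) - 2 * s i := fun i => by
        rw [kernel, if_pos (sub_pos.2 (hy i)), Real.cosh_eq, neg_sub, sub_eq_add_neg y,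
          sub_eq_add_neg (x i), Real.exp_add, Real.exp_add]
        push_cast
        ring
      simp only [peakonSolution, hk, Finset.sum_sub_distrib, Finset.sum_add_distrib,
        ← Finset.mul_sum]
      linear_combination (-(Real.exp y : ℂ)) * h0
    exact ⟨_, (hlim.norm.eventually_lt_const (lt_add_one _)).mono fun y hy => hy.le⟩

end EigenfunctionCandidate

/-- The kernel vanishes on the left half-line, so $\Psi(x_i)$ involves only the sources to the left
of $x_i$ and the strengths $z\,m_i\Psi(x_i)$ are found recursively; this yields the normalized
values. -/
theorem isEigenvalue_of_isRoot {x m : Fin 3 → ℝ} (hx : StrictMono x) {z : ℂ}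
    (hz : (specPoly x m).IsRoot z) : IsEigenvalue x m z := by
  have h01 : x 0 < x 1 := hx (by decide)
  have h12 : x 1 < x 2 := hx (by decide)
  have h02 := h01.trans h12
  have e0 := ofReal_exp_mul_exp_neg (x 0)
  have e1 := ofReal_exp_mul_exp_neg (x 1)
  have e2 := ofReal_exp_mul_exp_neg (x 2)
  have hk : ∀ {u v : ℝ}, v ≤ u → kernel (v - u) = 0 := fun h => if_neg (not_lt.2 (sub_nonpos.2 h))
  have hk' : ∀ {u v : ℝ}, u < v → 2 * kernel (v - u) =
      (Real.exp v : ℂ) * Real.exp (-u) + Real.exp u * Real.exp (-v) - 2 := fun {u v} h => by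
    rw [kernel, if_pos (sub_pos.2 h), Real.cosh_eq, neg_sub, sub_eq_add_neg v,
      sub_eq_add_neg u, Real.exp_add, Real.exp_add]
    push_cast
    ring
  have k01 := hk' h01
  have k02 := hk' h02
  have k12 := hk' h12
  rw [IsRoot.def, eval_specPoly] at hz
  refine ⟨peakonSolution x ![z * m 0 * Real.exp (x 0),
    z * m 1 * (normalizedValue₁ x m z * Real.exp (x 1)),
    z * m 2 * (normalizedValue₂ x m z * Real.exp (x 2))],
    isEigenfunction_peakonSolution hx (fun i => ?_) ?_⟩
  · fin_cases i <;>
      simp only [peakonSolution, Fin.sum_univ_three, Fin.zero_eta, Fin.mk_one, Fin.reduceFinMk,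
        Matrix.cons_val, hk le_rfl, hk h01.le, hk h12.le, hk h02.le, mul_zero, add_zero, sub_zero]
    · rw [normalizedValue₁]
      set E₀ := (Real.exp (x 0) : ℂ)
      set F₀ := (Real.exp (-x 0) : ℂ)
      set E₁ := (Real.exp (x 1) : ℂ)
      set F₁ := (Real.exp (-x 1) : ℂ)
      linear_combination z * m 1 * (z * m 0 * E₀ * k01 + z * m 0 * E₁ * e0 -
        z * m 0 * E₀ * (E₀ * F₁ - 2) * e1)
    · rw [normalizedValue₂]
      set E₀ := (Real.exp (x 0) : ℂ)
      set F₀ := (Real.exp (-x 0) : ℂ)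
      set E₁ := (Real.exp (x 1) : ℂ)
      set F₁ := (Real.exp (-x 1) : ℂ)
      set E₂ := (Real.exp (x 2) : ℂ)
      set F₂ := (Real.exp (-x 2) : ℂ)
      set φ := normalizedValue₁ x m z
      linear_combination z * m 2 * (z * m 0 * E₀ * k02 + z * m 0 * E₂ * e0 -
        z * m 0 * E₀ * (E₀ * F₂ - 2) * e2 + z * m 1 * φ * E₁ * k12 + z * m 1 * φ * E₂ * e1 -
        z * m 1 * φ * E₁ * (E₁ * F₂ - 2) * e2)
  · simp only [Fin.sum_univ_three, Matrix.cons_val]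
    linear_combination hz - z * m 0 * e0 - z * m 1 * normalizedValue₁ x m z * e1 -
      z * m 2 * normalizedValue₂ x m z * e2

theorem isEigenvalue_iff_isRoot {x m : Fin 3 → ℝ} (hx : StrictMono x) (z : ℂ) :
    IsEigenvalue x m z ↔ (specPoly x m).IsRoot z :=
  ⟨fun ⟨_, h⟩ => h.isRoot hx, isEigenvalue_of_isRoot hx⟩

/-! ### The roots of the spectral polynomial -/

theorem eval_specPoly_eq_prod {x m μ : Fin 3 → ℝ} (h1 : M₁ m = μ 0 + μ 1 + μ 2)
    (h2 : M₂ x m = μ 0 * μ 1 + μ 1 * μ 2 + μ 0 * μ 2) (h3 : M₃ x m = μ 0 * μ 1 * μ 2) (z : ℂ) :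
    (specPoly x m).eval z = (1 - μ 0 * z) * (1 - μ 1 * z) * (1 - μ 2 * z) := by
  simp only [specPoly, eval_sub, eval_add, eval_one, eval_mul, eval_C, eval_X, eval_pow, h1, h2,
    h3]
  push_cast
  ring

theorem isRoot_specPoly_iff {x m μ : Fin 3 → ℝ} (h1 : M₁ m = μ 0 + μ 1 + μ 2)
    (h2 : M₂ x m = μ 0 * μ 1 + μ 1 * μ 2 + μ 0 * μ 2) (h3 : M₃ x m = μ 0 * μ 1 * μ 2)
    (hμ : ∀ i, μ i ≠ 0) (z : ℂ) :
    (specPoly x m).IsRoot z ↔ ∃ i, z = 1 / (μ i : ℂ) := by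
  have hfac : ∀ i, 1 - (μ i : ℂ) * z = 0 ↔ z = 1 / (μ i : ℂ) := fun i => by
    have : (μ i : ℂ) ≠ 0 := Complex.ofReal_ne_zero.2 (hμ i)
    rw [eq_div_iff this, sub_eq_zero, eq_comm, mul_comm]
  rw [IsRoot.def, eval_specPoly_eq_prod h1 h2 h3, mul_eq_zero, mul_eq_zero, hfac, hfac, hfac]
  simp [Fin.exists_fin_succ, or_assoc]

/-- At $z=1/\mu_i$ only one term of the derivative of $\prod(1-\mu_jz)$ survives, namely
$-\mu_i\prod_{j\ne i}(1-\mu_j/\mu_i)$, which is nonzero because the $\mu_j$ are distinct. -/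
theorem rootMultiplicity_specPoly {x m μ : Fin 3 → ℝ} (h1 : M₁ m = μ 0 + μ 1 + μ 2)
    (h2 : M₂ x m = μ 0 * μ 1 + μ 1 * μ 2 + μ 0 * μ 2) (h3 : M₃ x m = μ 0 * μ 1 * μ 2)
    (hμ : ∀ i, μ i ≠ 0) (hinj : Function.Injective μ) {z : ℂ}
    (hz : (specPoly x m).IsRoot z) : (specPoly x m).rootMultiplicity z = 1 := by
  have hne : specPoly x m ≠ 0 := fun h => by
    have := eval_specPoly_eq_prod h1 h2 h3 0
    rw [h] at this
    simp at this
  refine le_antisymm (not_lt.1 fun hlt => ?_) ((rootMultiplicity_pos hne).2 hz)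
  have hd := ((one_lt_rootMultiplicity_iff_isRoot hne).1 hlt).2
  have hder : (derivative (specPoly x m)).eval z =
      -(μ 0 * ((1 - μ 1 * z) * (1 - μ 2 * z)) + μ 1 * ((1 - μ 0 * z) * (1 - μ 2 * z))
        + μ 2 * ((1 - μ 0 * z) * (1 - μ 1 * z))) := by
    simp only [specPoly, h1, h2, h3, derivative_sub, derivative_add, derivative_one,
      derivative_C_mul, derivative_X, derivative_X_pow, eval_sub, eval_add, eval_mul, eval_C,
      eval_X, eval_pow, eval_zero, eval_one]
    push_cast
    ring
  rw [IsRoot.def, hder] at hd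
  obtain ⟨i, rfl⟩ := (isRoot_specPoly_iff h1 h2 h3 hμ z).1 hz
  have hself : 1 - (μ i : ℂ) * (1 / (μ i : ℂ)) = 0 := by
    rw [mul_one_div_cancel (Complex.ofReal_ne_zero.2 (hμ i)), sub_self]
  have hother : ∀ j, j ≠ i → 1 - (μ j : ℂ) * (1 / (μ i : ℂ)) ≠ 0 := fun j hj h => by
    have hi : (μ i : ℂ) ≠ 0 := Complex.ofReal_ne_zero.2 (hμ i)
    rw [mul_one_div, sub_eq_zero, eq_comm, div_eq_one_iff_eq hi] at h
    exact hj (hinj (Complex.ofReal_injective h))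
  have hμ' : ∀ i, (μ i : ℂ) ≠ 0 := fun i => Complex.ofReal_ne_zero.2 (hμ i)
  fin_cases i
  · have ha := hother 1 (by decide)
    have hb := hother 2 (by decide)
    simp only [Fin.zero_eta] at hd ha hb hself
    rw [hself] at hd
    simp [ha, hb, hμ', -one_div] at hd
  · have ha := hother 0 (by decide)
    have hb := hother 2 (by decide)
    simp only [Fin.mk_one] at hd ha hb hself
    rw [hself] at hd
    simp [ha, hb, hμ', -one_div] at hd
  · have ha := hother 0 (by decide)
    have hb := hother 1 (by decide)
    simp only [Fin.reduceFinMk] at hd ha hb hself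
    rw [hself] at hd
    simp [ha, hb, hμ', -one_div] at hd

end Peakon

end

theorem mainTheorem5 (x₀ m₀ : Fin 3 → ℝ) (hx₀ : StrictMono x₀) (J : Set ℝ) (l : Filter ℝ)
    (hcase :
      (((m₀ 0 < 0 ∧ 0 < m₀ 1 ∧ 0 < m₀ 2) ∨ (m₀ 0 < 0 ∧ m₀ 1 < 0 ∧ 0 < m₀ 2)) ∧
        J = Set.Ici 0 ∧ l = Filter.atTop) ∨
      (((0 < m₀ 0 ∧ 0 < m₀ 1 ∧ m₀ 2 < 0) ∨ (0 < m₀ 0 ∧ m₀ 1 < 0 ∧ m₀ 2 < 0)) ∧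
        J = Set.Iic 0 ∧ l = Filter.atBot)) :
    ∃ x m : ℝ → Fin 3 → ℝ,
      -- global existence in one time direction, and uniqueness
      Peakon.IsSolutionOn J x m ∧ x 0 = x₀ ∧ m 0 = m₀ ∧
      (∀ y p : ℝ → Fin 3 → ℝ, Peakon.IsSolutionOn J y p → y 0 = x₀ → p 0 = m₀ →
        Set.EqOn y x J ∧ Set.EqOn p m J) ∧
      ∃ μ : Fin 3 → ℝ,
        -- the masses and the velocities have the same limits, nonzero and distinct
        (∀ i, Filter.Tendsto (fun t => m t i) l (nhds (μ i))) ∧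
        (∀ i, Filter.Tendsto (fun t => Peakon.velocity (x t) (m t) i) l (nhds (μ i))) ∧
        (∀ i, μ i ≠ 0) ∧ Function.Injective μ ∧
        -- the peakons separate linearly
        (∀ i j, i < j →
          Filter.Tendsto (fun t => (x t j - x t i) / |t|) l (nhds |μ j - μ i|)) ∧
        -- the spectrum
        ∀ t ∈ J,
          (∀ z : ℂ, Peakon.IsEigenvalue (x t) (m t) z ↔
            (Peakon.specPoly (x t) (m t)).IsRoot z) ∧
          (∀ z : ℂ, (Peakon.specPoly (x t) (m t)).IsRoot z →
            z.im = 0 ∧ z ≠ 0 ∧ (Peakon.specPoly (x t) (m t)).rootMultiplicity z = 1) ∧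
          (∀ z : ℂ, (Peakon.specPoly (x t) (m t)).IsRoot z ↔ ∃ i, z = 1 / (μ i : ℂ)) := by
  have hscat : Peakon.HasScattering x₀ m₀ J l := by
    rcases hcase with ⟨hm, rfl, rfl⟩ | ⟨hm, rfl, rfl⟩
    · exact Peakon.hasScattering_atTop hx₀ hm
    · exact Peakon.hasScattering_atBot hx₀ hm
  obtain ⟨x, m, hsol, hx, hm, huniq, μ, hμm, hμv, hμ0, hinj, hsep, hM⟩ := hscat
  refine ⟨x, m, hsol, hx, hm, huniq, μ, hμm, hμv, hμ0, hinj, hsep, fun t ht => ?_⟩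
  obtain ⟨h1, h2, h3⟩ := hM t ht
  have hroot := Peakon.isRoot_specPoly_iff h1 h2 h3 hμ0
  refine ⟨Peakon.isEigenvalue_iff_isRoot (hsol.ordered t ht), fun z hz => ⟨?_, ?_,
    Peakon.rootMultiplicity_specPoly h1 h2 h3 hμ0 hinj hz⟩, hroot⟩
  · obtain ⟨i, rfl⟩ := (hroot z).1 hz
    rw [← Complex.ofReal_one, ← Complex.ofReal_div, Complex.ofReal_im]
  · obtain ⟨i, rfl⟩ := (hroot z).1 hz
    exact one_div_ne_zero (Complex.ofReal_ne_zero.2 (hμ0 i))
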